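/- Let $\alpha_0,\alpha_1\in(-1,1)$, $\beta_0,\beta_1\in\mathbb{R}$, $\sigma^2>0$, $\rho\in(-1,1)$, and let $(X_n)_{n\ge 1}$ be real random variables satisfying the bifurcating autoregressive model $$X_{2n}=\alpha_0X_n+\beta_0+\varepsilon_{2n},\qquad X_{2n+1}=\alpha_1X_n+\beta_1+\varepsilon_{2n+1}\qquad(n\ge 1),$$ where the pairs $(\varepsilon_{2n},\varepsilon_{2n+1})$, $n\ge 1$, are i.i.d. centered bivariate Gaussian with covariance matrix $\sigma^2\begin{pmatrix}1&\rho\\ \rho&1\end{pmatrix}$ and are independent of $X_1$. Assume that the law $\nu$ of $X_1$ has finite moments of all orders. For $x\in\mathbb{R}$, let $P(x,\cdot)$ be the law on $\mathbb{R}^2$ of $(\alpha_0x+\beta_0+\varepsilon_2,\ \alpha_1x+\beta_1+\varepsilon_3)$, let $P_0(x,\cdot)$ and $P_1(x,\cdot)$ be its two marginals, and let $Q=\tfrac12(P_0+P_1)$. For $f:\mathbb{R}^3\to\mathbb{R}$ write $Pf(x)=\int f(x,y,z)\,P(x,dy\,dz)$. Let $\mathbb{G}_q=\{2^q,\dots,2^{q+1}-1\}$,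 $\mathbb{T}_r=\bigcup_{q=0}^r\mathbb{G}_q$ and $\Delta_i=(X_i,X_{2i},X_{2i+1})$. For $d\in\{1,3\}$, let $C_{\mathrm{pol}}(\mathbb{R}^d)$ be the set of continuous $f:\mathbb{R}^d\to\mathbb{R}$ such that $|f(x)|\le c(1+\|x\|^m)$ for all $x\in\mathbb{R}^d$, for some $c\ge 0$ and $m\in\mathbb{N}$. Then the Markov transition kernel $Q$ on $\mathbb{R}$ has a unique stationary probability distribution $\mu$; every $f\in C_{\mathrm{pol}}(\mathbb{R})$ is $\mu$-integrable; for every $f\in C_{\mathrm{pol}}(\mathbb{R}^3)$, the integral $Pf(x)$ converges absolutely for every $x\in\mathbb{R}$, and $Pf$ is $\mu$-integrable; and: (i) almost surely, for every $f\in C_{\mathrm{pol}}(\mathbb{R})$, both $\frac{1}{|\mathbb{G}_q|}\sum_{i\in\mathbb{G}_q}f(X_i)$ (as $q\to\infty$) and $\frac{1}{|\mathbb{T}_r|}\sum_{i\in\mathbb{T}_r}f(X_i)$ (as $r\to\infty$) converge to $\int f\,d\mu$; (ii) almost surely, for every $f\in C_{\mathrm{pol}}(\mathbb{R}^3)$,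 both $\frac{1}{|\mathbb{G}_q|}\sum_{i\in\mathbb{G}_q}f(\Delta_i)$ (as $q\to\infty$) and $\frac{1}{|\mathbb{T}_r|}\sum_{i\in\mathbb{T}_r}f(\Delta_i)$ (as $r\to\infty$) converge to $\int Pf\,d\mu$. -/

import Mathlib

open MeasureTheory ProbabilityTheory Filter
open scoped ENNReal Topology

namespace BAR

/-! ### The binary tree
The vertices are the positive integers; the daughters of `n` are `2 * n` and `2 * n + 1`.
Families indexed by the tree are written as families indexed by `ℕ`, whose value at `0` is never
used. -/

/-- The `q`-th generation `{2 ^ q, …, 2 ^ (q + 1) - 1}`. -/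
def generation (q : ℕ) : Finset ℕ := Finset.Ico (2 ^ q) (2 ^ (q + 1))

/-- The subtree made of the generations `0, …, r`. -/
def subtree (r : ℕ) : Finset ℕ := (Finset.range (r + 1)).biUnion generation

/-- The empirical average `|I|⁻¹ ∑ i ∈ I, f (Z i)` of `f` over a finite set `I` of vertices, for a
family `Z` of observations attached to the vertices. -/
noncomputable def average {E : Type*} (I : Finset ℕ) (Z : ℕ → E) (f : E → ℝ) : ℝ :=
  (I.card : ℝ)⁻¹ * ∑ i ∈ I, f (Z i)

/-- The mother-daughters triangle `(X n, X (2 * n), X (2 * n + 1))`. -/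
def triangle {S : Type*} (X : ℕ → S) (n : ℕ) : S × S × S := (X n, X (2 * n), X (2 * n + 1))

/-! ### Continuous, polynomially growing functions -/

/-- `f` is continuous and `|f x| ≤ c (1 + ‖x‖ ^ m)` for some `c ≥ 0` and `m ∈ ℕ`. On a finite
dimensional space, this does not depend on the choice of the norm. -/
def IsCPol {E : Type*} [NormedAddCommGroup E] (f : E → ℝ) : Prop :=
  Continuous f ∧ ∃ c : ℝ, 0 ≤ c ∧ ∃ m : ℕ, ∀ x, |f x| ≤ c * (1 + ‖x‖ ^ m)

/-! ### Transition probabilities on the tree -/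

section Transition

variable {S : Type*} [MeasurableSpace S]

/-- The function `P f : x ↦ ∫ f (x, y, z) P(x, dy dz)`. -/
noncomputable def applyTriangle (P : Kernel S (S × S)) (f : S × S × S → ℝ) (x : S) : ℝ :=
  ∫ yz, f (x, yz.1, yz.2) ∂(P x)

/-- The transition probability `Q = (P₀ + P₁) / 2` of the induced Markov chain, which follows a
lineage by choosing one of the two daughters with a balanced coin at each step; here `P₀` and `P₁`
are the two marginals of `P`. -/
noncomputable def inducedKernel (P : Kernel S (S × S)) : Kernel S S where
  toFun x := (2⁻¹ : ℝ≥0∞) • (P.fst x + P.snd x)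
  measurable' := by
    refine Measure.measurable_of_measurable_coe _ fun s hs => ?_
    simp only [Measure.smul_apply, Measure.add_apply, smul_eq_mul]
    exact ((P.fst.measurable_coe hs).add (P.snd.measurable_coe hs)).const_mul _

/-- `μ` is the unique stationary distribution of a Markov chain with transition probability `Q`. -/
structure IsUniqueStationary (Q : Kernel S S) (μ : Measure S) : Prop where
  isProbabilityMeasure : IsProbabilityMeasure μ
  invariant : Q.Invariant μ
  unique : ∀ μ' : Measure S, IsProbabilityMeasure μ' → Q.Invariant μ' → μ' = μ

end Transition

/-! ### The bifurcating autoregressive model -/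

/-- The covariance matrix `σ² (1 ρ; ρ 1)` of the noise. -/
def noiseCov (σ ρ : ℝ) : Matrix (Fin 2) (Fin 2) ℝ := σ ^ 2 • !![1, ρ; ρ, 1]

/-- The centered bivariate Gaussian law with covariance matrix `noiseCov σ ρ`, on `ℝ × ℝ`. -/
noncomputable def noiseLaw (σ ρ : ℝ) : Measure (ℝ × ℝ) :=
  (multivariateGaussian 0 (noiseCov σ ρ)).map fun v => (v 0, v 1)

/-- The transition probability of the model: `P(x, ·)` is the law of
`(α₀ x + β₀ + e.1, α₁ x + β₁ + e.2)`, where `e` has law `noiseLaw σ ρ`. -/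
noncomputable def transition (α₀ β₀ α₁ β₁ σ ρ : ℝ) : Kernel ℝ (ℝ × ℝ) where
  toFun x := (noiseLaw σ ρ).map fun e => (α₀ * x + β₀ + e.1, α₁ * x + β₁ + e.2)
  measurable' := by
    refine Measure.measurable_of_measurable_coe _ fun s hs => ?_
    have hm : Measurable fun p : ℝ × (ℝ × ℝ) =>
        (α₀ * p.1 + β₀ + p.2.1, α₁ * p.1 + β₁ + p.2.2) := by fun_prop
    have : IsFiniteMeasure (noiseLaw σ ρ) := by unfold noiseLaw; infer_instance
    convert measurable_measure_prodMk_left (ν := noiseLaw σ ρ) (hm hs) using 2 with x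
    rw [Measure.map_apply (by fun_prop) hs]
    rfl

/-- The family `(X n)_{n ≥ 1}` follows the bifurcating autoregressive model with parameters
`α₀, β₀, α₁, β₁, σ, ρ`, noise `(ε n)_{n ≥ 2}` and initial distribution `ν`:
`X (2 n) = α₀ X n + β₀ + ε (2 n)` and `X (2 n + 1) = α₁ X n + β₁ + ε (2 n + 1)`, where the pairs
`(ε (2 n), ε (2 n + 1))`, `n ≥ 1`, are i.i.d. centered Gaussian with covariance matrix
`σ² (1 ρ; ρ 1)`, and are independent of the ancestor `X 1`, whose law is `ν`. -/
structure IsModel {Ω : Type*} [MeasurableSpace Ω] (Pr : Measure Ω) (α₀ β₀ α₁ β₁ σ ρ : ℝ)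
    (ν : Measure ℝ) (X ε : ℕ → Ω → ℝ) : Prop where
  ancestor : HasLaw (X 1) ν Pr
  noise_law : ∀ n : ℕ, 1 ≤ n →
    HasLaw (fun ω => (ε (2 * n) ω, ε (2 * n + 1) ω)) (noiseLaw σ ρ) Pr
  noise_indep : iIndepFun (fun (n : ℕ+) ω => (ε (2 * n) ω, ε (2 * n + 1) ω)) Pr
  ancestor_indep :
    IndepFun (X 1) (fun ω (n : ℕ+) => (ε (2 * n) ω, ε (2 * n + 1) ω)) Pr
  even : ∀ n : ℕ, 1 ≤ n → ∀ᵐ ω ∂Pr, X (2 * n) ω = α₀ * X n ω + β₀ + ε (2 * n) ω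
  odd : ∀ n : ℕ, 1 ≤ n → ∀ᵐ ω ∂Pr, X (2 * n + 1) ω = α₁ * X n ω + β₁ + ε (2 * n + 1) ω

end BAR

namespace BAR

/-! ### Elementary estimates -/

/-! The model is a random contraction: the daughters of a mother of type x are `G x e`, with `‖G x e
- G y e‖ ≤ a * |x - y|`, where `a = max |α₀| |α₁| < 1` and `e` is Gaussian. Hence `Q`, written
`meanOp`, maps a bounded L-Lipschitz g to a bounded (aL)-Lipschitz function with the same bound, and
Q^k g flattens geometrically to a constant. The drift inequality `‖G x e‖ ^ p ≤ b * ‖x‖ ^ p + C * ‖G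
0 e‖ ^ p`, with b < 1, bounds every moment of the chain started at 0. Tightness then gives a
stationary μ with all moments (`exists_stepLaw_eq`). For any stationary law the limiting constant is
its integral of g, whence uniqueness.

On the tree, the numbering of the vertices gives a filtration. Each fluctuation f(Δ_n) - Pf(X_n) is
orthogonal to the bounded functions of the past, so for bounded f the mean fluctuation over
generation q has second moment O(2^{-q}). This is summable, so the mean tends to 0 almost surely
(`ae_tendsto_average_sub`). Applied k times, it shows that the average of g over generation q + k is
asymptotically that of Q^k g over generation q. The latter differs from ∫ g dμ by at most L a^k
times an empirical first moment, plus |Q^k g(0) - ∫ g dμ|. The drift inequality and the strong law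
for the noise bound the empirical moments; let q, then k, tend to infinity.

This treats one bounded Lipschitz function at a time. A countable determining family and the moment
bounds yield a single null set for all continuous functions of polynomial growth
(`exists_countable_determining`). Triangles follow because Pf is bounded Lipschitz when f is, and
subtrees by weighted Cesàro means. -/

theorem mul_add_pow_le {a : ℝ} (ha0 : 0 ≤ a) (ha : a < 1) {m : ℕ} (hm : m ≠ 0) :
    ∃ b C : ℝ, 0 ≤ b ∧ b < 1 ∧ 0 ≤ C ∧
      ∀ x t : ℝ, 0 ≤ x → 0 ≤ t → (a * x + t) ^ m ≤ b * x ^ m + C * t ^ m := by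
  -- With a < b < 1, either t ≤ (b - a) x and t is absorbed into b x, or x ≤ t / (b - a) and the
  -- whole sum is a multiple of t.
  obtain ⟨b, hab, hb1⟩ := exists_between ha
  have hb0 : 0 ≤ b := ha0.trans hab.le
  refine ⟨b ^ m, (a / (b - a) + 1) ^ m, by positivity, pow_lt_one₀ hb0 hb1 hm, ?_, ?_⟩
  · have : 0 ≤ a / (b - a) := div_nonneg ha0 (by linarith)
    positivity
  intro x t hx ht
  have hd : 0 < b - a := by linarith
  rcases le_total t ((b - a) * x) with h | h
  · have h1 : (a * x + t) ^ m ≤ (b * x) ^ m := by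
      gcongr
      linarith
    have h2 : 0 ≤ (a / (b - a) + 1) ^ m * t ^ m := by positivity
    rw [mul_pow] at h1
    linarith
  · have h3 : x ≤ t / (b - a) := by
      rw [le_div_iff₀ hd]; linarith
    have h1 : (a * x + t) ^ m ≤ ((a / (b - a) + 1) * t) ^ m := by
      gcongr
      calc a * x + t ≤ a * (t / (b - a)) + t := by gcongr
        _ = (a / (b - a) + 1) * t := by ring
    have h2 : 0 ≤ b ^ m * x ^ m := by positivity
    rw [mul_pow] at h1
    linarith

theorem bddAbove_of_contracting {u v : ℕ → ℝ} {b M : ℝ} (hb0 : 0 ≤ b) (hb : b < 1)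
    (hv : ∀ n, v n ≤ M) (h : ∀ n, u (n + 1) ≤ b * u n + v n) : ∃ K, ∀ n, u n ≤ K := by
  -- `M / (1 - b)` is the fixed point of t ↦ b t + M, so everything above it is mapped below itself.
  refine ⟨max (u 0) (M / (1 - b)), fun n => ?_⟩
  induction n with
  | zero => exact le_max_left _ _
  | succ n ih =>
    have h1 : M / (1 - b) ≤ max (u 0) (M / (1 - b)) := le_max_right _ _
    rw [div_le_iff₀ (by linarith)] at h1
    nlinarith [h n, hv n, mul_le_mul_of_nonneg_left ih hb0]

theorem tendsto_zero_of_summable_sq {u : ℕ → ℝ} (h : Summable fun n => u n ^ 2) :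
    Tendsto u atTop (𝓝 0) := by
  have := h.tendsto_atTop_zero
  have h2 := (Real.continuous_sqrt.tendsto 0).comp this
  refine (tendsto_zero_iff_abs_tendsto_zero _).2 ?_
  simpa [Function.comp_def, Real.sqrt_sq_eq_abs] using h2

/-! ### Averages over generations and subtrees -/

theorem card_generation (q : ℕ) : (generation q).card = 2 ^ q := by
  simp [generation, pow_succ]; omega

theorem generation_nonempty (q : ℕ) : (generation q).Nonempty := by
  rw [← Finset.card_pos, card_generation]; positivity

theorem one_le_of_mem_generation {q i : ℕ} (h : i ∈ generation q) : 1 ≤ i := by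
  rw [generation, Finset.mem_Ico] at h
  exact (Nat.one_le_two_pow).trans h.1

theorem pairwiseDisjoint_generation (s : Set ℕ) : s.PairwiseDisjoint generation := by
  have : ∀ i j, i < j → Disjoint (generation i) (generation j) := by
    intro i j hij
    rw [Finset.disjoint_left]
    intro n hn hn'
    simp only [generation, Finset.mem_Ico] at hn hn'
    have : 2 ^ (i + 1) ≤ 2 ^ j := Nat.pow_le_pow_right (by norm_num) hij
    omega
  intro i _ j _ hij
  rcases lt_or_gt_of_ne hij with h | h
  · exact this _ _ h
  · exact (this _ _ h).symm

theorem sum_subtree (r : ℕ) (f : ℕ → ℝ) :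
    ∑ i ∈ subtree r, f i = ∑ q ∈ Finset.range (r + 1), ∑ i ∈ generation q, f i := by
  rw [subtree, Finset.sum_biUnion (pairwiseDisjoint_generation _)]

theorem sum_generation_succ (q : ℕ) (f : ℕ → ℝ) :
    ∑ i ∈ generation (q + 1), f i = ∑ i ∈ generation q, (f (2 * i) + f (2 * i + 1)) := by
  have : ∀ a n : ℕ, ∑ i ∈ Finset.Ico (2 * a) (2 * (a + n)), f i
      = ∑ i ∈ Finset.Ico a (a + n), (f (2 * i) + f (2 * i + 1)) := by
    intro a n
    induction n with
    | zero => simp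
    | succ n ih =>
      rw [← add_assoc, Finset.sum_Ico_succ_top (by omega), ← ih,
        show 2 * (a + n + 1) = 2 * (a + n) + 1 + 1 by ring,
        Finset.sum_Ico_succ_top (by omega), Finset.sum_Ico_succ_top (by omega)]
      ring
  have h := this (2 ^ q) (2 ^ q)
  rw [generation, generation]
  convert h using 2
  · rw [show 2 * (2 ^ q + 2 ^ q) = 2 ^ (q + 1 + 1) by ring, pow_succ' 2 q]
  · rw [show 2 ^ q + 2 ^ q = 2 ^ (q + 1) by ring]

section Average

variable {E : Type*}

theorem average_const {I : Finset ℕ} (hI : I.Nonempty) (Z : ℕ → E) (c : ℝ) :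
    average I Z (fun _ => c) = c := by
  have : (I.card : ℝ) ≠ 0 := by exact_mod_cast hI.card_pos.ne'
  simp [average]; field_simp

theorem average_mono {I : Finset ℕ} {Z : ℕ → E} {f g : E → ℝ}
    (h : ∀ i ∈ I, f (Z i) ≤ g (Z i)) : average I Z f ≤ average I Z g :=
  mul_le_mul_of_nonneg_left (Finset.sum_le_sum h) (by positivity)

theorem average_add (I : Finset ℕ) (Z : ℕ → E) (f g : E → ℝ) :
    average I Z (fun x => f x + g x) = average I Z f + average I Z g := by
  simp [average, Finset.sum_add_distrib, mul_add]

theorem average_const_mul (I : Finset ℕ) (Z : ℕ → E) (c : ℝ) (f : E → ℝ) :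
    average I Z (fun x => c * f x) = c * average I Z f := by
  simp only [average, ← Finset.mul_sum]; ring

theorem average_generation_succ (q : ℕ) (Z : ℕ → E) (f : E → ℝ) :
    average (generation (q + 1)) Z f
      = average (generation q) (triangle Z) fun d => (f d.2.1 + f d.2.2) / 2 := by
  simp only [average, sum_generation_succ, card_generation, triangle, ← Finset.sum_div]
  push_cast
  rw [pow_succ]
  field_simp

/-- A subtree average is the mean of the generation averages with weights 2^q. The total weight
diverges, so Cesàro summation applies. -/
theorem tendsto_average_subtree {Z : ℕ → E} {f : E → ℝ} {l : ℝ}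
    (h : Tendsto (fun q => average (generation q) Z f) atTop (𝓝 l)) :
    Tendsto (fun r => average (subtree r) Z f) atTop (𝓝 l) := by
  have hcard : ∀ r, ((subtree r).card : ℝ) = ∑ q ∈ Finset.range (r + 1), (2 : ℝ) ^ q := by
    intro r
    rw [subtree, Finset.card_biUnion fun i hi j hj hij =>
      pairwiseDisjoint_generation _ (Set.mem_univ i) (Set.mem_univ j) hij]
    simp [card_generation]
  have hgeom : Tendsto (fun n => ∑ q ∈ Finset.range n, (2 : ℝ) ^ q) atTop atTop := by
    refine tendsto_atTop_mono (fun n => ?_) tendsto_natCast_atTop_atTop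
    calc (n : ℝ) = ∑ q ∈ Finset.range n, (1 : ℝ) := by simp
      _ ≤ _ := Finset.sum_le_sum fun q _ => one_le_pow₀ (by norm_num)
  have ho : (fun q => (2 : ℝ) ^ q * (average (generation q) Z f - l))
      =o[atTop] fun q => (2 : ℝ) ^ q := by
    have h0 : Tendsto (fun q => average (generation q) Z f - l) atTop (𝓝 0) := by
      simpa using h.sub_const l
    have := (Asymptotics.isBigO_refl (fun q : ℕ => (2 : ℝ) ^ q) atTop).mul_isLittleO
      ((Asymptotics.isLittleO_one_iff ℝ).2 h0)
    simpa using this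
  have hs := ho.sum_range (fun q => by positivity) hgeom
  have ht := (hs.tendsto_div_nhds_zero.comp (tendsto_add_atTop_nat 1)).add_const l
  rw [zero_add] at ht
  refine ht.congr fun r => ?_
  have hpos : (0 : ℝ) < ∑ q ∈ Finset.range (r + 1), (2 : ℝ) ^ q :=
    Finset.sum_pos (fun q _ => by positivity) (by simp)
  have hgen : ∀ q, (2 : ℝ) ^ q * average (generation q) Z f = ∑ i ∈ generation q, f (Z i) := by
    intro q
    rw [average, card_generation]
    push_cast
    field_simp
  simp only [Function.comp_apply, average, mul_sub, Finset.sum_sub_distrib, sum_subtree, hcard]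
  rw [← Finset.sum_mul]
  simp only [average] at hgen
  simp only [hgen]
  field_simp
  ring

end Average

/-! ### Bounded Lipschitz functions and convergence against polynomially growing functions -/

/-- `g` is bounded and Lipschitz. -/
def IsBoundedLipschitz {E : Type*} [PseudoMetricSpace E] (g : E → ℝ) : Prop :=
  (∃ B : ℝ, ∀ x, |g x| ≤ B) ∧ ∃ L, LipschitzWith L g

/-- The integrals of the weight `w` are bounded by `M` uniformly in n, so the approximation error is
at most δ|M| for all the measures at once and the limits may be exchanged. -/
theorem tendsto_integral_of_approx {E : Type*} [MeasurableSpace E] {μs : ℕ → Measure E}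
    {m : Measure E} {f w : E → ℝ} {M : ℝ}
    (hfs : ∀ n, Integrable f (μs n)) (hfm : Integrable f m)
    (hws : ∀ n, Integrable w (μs n)) (hwm : Integrable w m)
    (hMs : ∀ n, ∫ x, w x ∂μs n ≤ M) (hMm : ∫ x, w x ∂m ≤ M)
    (h : ∀ δ > 0, ∃ f' : E → ℝ, (∀ n, Integrable f' (μs n)) ∧ Integrable f' m ∧
      (∀ x, |f x - f' x| ≤ δ * w x) ∧
      Tendsto (fun n => ∫ x, f' x ∂μs n) atTop (𝓝 (∫ x, f' x ∂m))) :
    Tendsto (fun n => ∫ x, f x ∂μs n) atTop (𝓝 (∫ x, f x ∂m)) := by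
  have key : ∀ (ν : Measure E) (f' : E → ℝ) (δ : ℝ), 0 < δ → Integrable f ν → Integrable f' ν →
      Integrable w ν → ∫ x, w x ∂ν ≤ M → (∀ x, |f x - f' x| ≤ δ * w x) →
      |∫ x, f x ∂ν - ∫ x, f' x ∂ν| ≤ δ * |M| := by
    intro ν f' δ hδ hf hf' hw hM hb
    rw [← integral_sub hf hf']
    calc |∫ x, f x - f' x ∂ν| ≤ ∫ x, |f x - f' x| ∂ν := abs_integral_le_integral_abs
      _ ≤ ∫ x, δ * w x ∂ν := integral_mono (hf.sub hf').abs (hw.const_mul δ) hb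
      _ = δ * ∫ x, w x ∂ν := integral_const_mul _ _
      _ ≤ δ * |M| := by gcongr; exact hM.trans (le_abs_self M)
  rw [Metric.tendsto_atTop]
  intro η hη
  -- The `+ 1` keeps the denominator positive when `M = 0`.
  have hδ : 0 < η / (3 * (|M| + 1)) := by positivity
  obtain ⟨f', hf's, hf'm, hb, ht⟩ := h _ hδ
  obtain ⟨n₀, hn₀⟩ := Metric.tendsto_atTop.1 ht (η / 3) (by positivity)
  refine ⟨n₀, fun n hn => ?_⟩
  have h1 := key (μs n) f' _ hδ (hfs n) (hf's n) (hws n) (hMs n) hb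
  have h2 := key m f' _ hδ hfm hf'm hwm hMm hb
  have h3 := hn₀ n hn
  have h4 : η / (3 * (|M| + 1)) * |M| < η / 3 := by
    rw [div_mul_eq_mul_div, div_lt_div_iff₀ (by positivity) (by norm_num)]
    nlinarith [abs_nonneg M]
  rw [Real.dist_eq] at h3 ⊢
  rw [abs_le] at h1 h2
  rw [abs_lt] at h3 ⊢
  constructor <;> linarith [h1.1, h1.2, h2.1, h2.2, h3.1, h3.2]

section Determining

variable {E : Type*} [NormedAddCommGroup E]

/-- A continuous cutoff, equal to `1` on the ball of radius `N` and to `0` outside of the ball of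
radius `N + 1`. -/
noncomputable def cutoff (N : ℕ) (x : E) : ℝ := max 0 (min 1 (N + 1 - ‖x‖))

theorem cutoff_nonneg (N : ℕ) (x : E) : 0 ≤ cutoff N x := le_max_left _ _

theorem cutoff_le_one (N : ℕ) (x : E) : cutoff N x ≤ 1 := by simp [cutoff]

theorem cutoff_eq_zero {N : ℕ} {x : E} (h : (N : ℝ) + 1 ≤ ‖x‖) : cutoff N x = 0 :=
  max_eq_left ((min_le_right _ _).trans (by linarith))

/-- A pointwise Markov inequality: discarding the region beyond radius N gains a factor 1/N at the
price of one more power of the norm. -/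
theorem one_sub_cutoff_mul_le (N : ℕ) (x : E) : (1 - cutoff N x) * N ≤ ‖x‖ := by
  rcases le_total ‖x‖ N with h | h
  · have : cutoff N x = 1 := by
      rw [cutoff, min_eq_left (by linarith), max_eq_right zero_le_one]
    simp [this]
  · nlinarith [cutoff_nonneg N x]

theorem lipschitzWith_cutoff (N : ℕ) : LipschitzWith 1 (cutoff N : E → ℝ) := by
  have h : LipschitzWith 1 fun x : E => (N : ℝ) + 1 - ‖x‖ := by
    refine LipschitzWith.of_dist_le_mul fun x y => ?_
    rw [Real.dist_eq, dist_eq_norm, NNReal.coe_one, one_mul, abs_sub_comm]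
    convert abs_norm_sub_norm_le x y using 2
    ring
  exact (h.const_min 1).const_max 0

theorem IsBoundedLipschitz.cutoff_mul {g : E → ℝ} (hg : IsBoundedLipschitz g) (N : ℕ) :
    IsBoundedLipschitz fun x => cutoff N x * g x := by
  obtain ⟨⟨B, hB⟩, L, hL⟩ := hg
  have hB0 : 0 ≤ B := (abs_nonneg _).trans (hB 0)
  refine ⟨⟨B, fun x => ?_⟩, B.toNNReal + L, LipschitzWith.of_dist_le_mul fun x y => ?_⟩
  · rw [abs_mul, abs_of_nonneg (cutoff_nonneg N x)]
    nlinarith [cutoff_nonneg N x, cutoff_le_one N x, hB x, abs_nonneg (g x)]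
  · have h1 := (lipschitzWith_cutoff (E := E) N).dist_le_mul x y
    have h2 := hL.dist_le_mul x y
    rw [Real.dist_eq] at h1 h2 ⊢
    simp only [NNReal.coe_one, one_mul, NNReal.coe_add, Real.coe_toNNReal B hB0] at h1 h2 ⊢
    calc |cutoff N x * g x - cutoff N y * g y|
        = |(cutoff N x - cutoff N y) * g x + cutoff N y * (g x - g y)| := by ring_nf
      _ ≤ |(cutoff N x - cutoff N y) * g x| + |cutoff N y * (g x - g y)| := abs_add_le _ _
      _ = |cutoff N x - cutoff N y| * |g x| + cutoff N y * |g x - g y| := by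
          rw [abs_mul, abs_mul, abs_of_nonneg (cutoff_nonneg N y)]
      _ ≤ dist x y * B + 1 * (L * dist x y) := by
          gcongr
          · exact hB x
          · exact cutoff_le_one N y
      _ = (B + L) * dist x y := by ring

theorem IsBoundedLipschitz.continuous {g : E → ℝ} (hg : IsBoundedLipschitz g) : Continuous g :=
  hg.2.choose_spec.continuous

variable [MeasurableSpace E]

/-- `m` is a probability measure with finite moments of all orders. -/
structure HasMoments (m : Measure E) : Prop where
  isProbabilityMeasure : IsProbabilityMeasure m
  integrable_norm_pow : ∀ k : ℕ, Integrable (fun x => ‖x‖ ^ k) m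

variable [BorelSpace E]

theorem IsBoundedLipschitz.integrable {g : E → ℝ} (hg : IsBoundedLipschitz g) (m : Measure E)
    [IsFiniteMeasure m] : Integrable g m := by
  obtain ⟨B, hB⟩ := hg.1
  exact Integrable.of_bound hg.continuous.measurable.aestronglyMeasurable B (ae_of_all _ hB)

theorem HasMoments.integrable {m : Measure E} (hm : HasMoments m) {f : E → ℝ} (hf : IsCPol f) :
    Integrable f m := by
  have := hm.isProbabilityMeasure
  obtain ⟨c, -, k, hc⟩ := hf.2
  refine (((integrable_const 1).add (hm.integrable_norm_pow k)).const_mul c).mono'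
    hf.1.measurable.aestronglyMeasurable (ae_of_all _ hc)

/-- Given bounds on all moments, weak convergence of probability measures implies the convergence of
the integrals of all continuous functions of polynomial growth. -/
theorem tendsto_integral_of_isCPol {μs : ℕ → Measure E} {m : Measure E}
    (hμs : ∀ n, HasMoments (μs n)) (hm : HasMoments m)
    (hM : ∀ k : ℕ, ∃ M : ℝ, ∀ n, ∫ x, ‖x‖ ^ k ∂μs n ≤ M)
    (h : ∀ g : E → ℝ, Continuous g → (∃ B, ∀ x, |g x| ≤ B) →
      Tendsto (fun n => ∫ x, g x ∂μs n) atTop (𝓝 (∫ x, g x ∂m)))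
    {f : E → ℝ} (hf : IsCPol f) :
    Tendsto (fun n => ∫ x, f x ∂μs n) atTop (𝓝 (∫ x, f x ∂m)) := by
  have hfc := hf.1
  obtain ⟨c, hc0, k, hc⟩ := hf.2
  have hint : ∀ {ν : Measure E}, HasMoments ν → Integrable (fun x => ‖x‖ ^ 1 + ‖x‖ ^ (k + 1)) ν :=
    fun hν => (hν.integrable_norm_pow 1).add (hν.integrable_norm_pow (k + 1))
  obtain ⟨M₁, hM₁⟩ := hM 1
  obtain ⟨M₂, hM₂⟩ := hM (k + 1)
  refine tendsto_integral_of_approx (w := fun x => ‖x‖ ^ 1 + ‖x‖ ^ (k + 1))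
    (M := max (M₁ + M₂) (∫ x, ‖x‖ ^ 1 + ‖x‖ ^ (k + 1) ∂m))
    (fun n => (hμs n).integrable hf) (hm.integrable hf) (fun n => hint (hμs n)) (hint hm)
    (fun n => ?_) (le_max_right _ _) fun δ hδ => ?_
  · rw [integral_add ((hμs n).integrable_norm_pow 1) ((hμs n).integrable_norm_pow (k + 1))]
    exact (add_le_add (hM₁ n) (hM₂ n)).trans (le_max_left _ _)
  -- Since c < Nδ, the removed part `(1 - cutoff N x) * |f x|` is at most δ‖x‖(1 + ‖x‖^k), which is
  -- δ times the chosen weight.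
  obtain ⟨N, hN⟩ := exists_nat_gt (c / δ)
  have hN0 : (0 : ℝ) < N := (div_nonneg hc0 hδ.le).trans_lt hN
  rw [div_lt_iff₀ hδ] at hN
  have hcont : Continuous fun x => cutoff N x * f x := (lipschitzWith_cutoff N).continuous.mul hfc
  have hbdd : ∀ x, |cutoff N x * f x| ≤ c * (1 + ((N : ℝ) + 1) ^ k) := by
    intro x
    rw [abs_mul, abs_of_nonneg (cutoff_nonneg N x)]
    rcases le_total ((N : ℝ) + 1) ‖x‖ with h' | h'
    · rw [cutoff_eq_zero h', zero_mul]; positivity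
    · calc cutoff N x * |f x| ≤ 1 * (c * (1 + ‖x‖ ^ k)) := by
            gcongr
            · exact cutoff_le_one N x
            · exact hc x
        _ ≤ c * (1 + ((N : ℝ) + 1) ^ k) := by rw [one_mul]; gcongr
  have hi : ∀ {ν : Measure E}, HasMoments ν → Integrable (fun x => cutoff N x * f x) ν := by
    intro ν hν
    have := hν.isProbabilityMeasure
    exact Integrable.of_bound hcont.measurable.aestronglyMeasurable _ (ae_of_all _ hbdd)
  refine ⟨fun x => cutoff N x * f x, fun n => hi (hμs n), hi hm, fun x => ?_, h _ hcont ⟨_, hbdd⟩⟩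
  have h1 : |f x - cutoff N x * f x| = (1 - cutoff N x) * |f x| := by
    rw [show f x - cutoff N x * f x = (1 - cutoff N x) * f x by ring, abs_mul,
      abs_of_nonneg (by linarith [cutoff_le_one N x])]
  rw [h1]
  have h2 := one_sub_cutoff_mul_le N x
  have h3 : 0 ≤ 1 - cutoff N x := by linarith [cutoff_le_one N x]
  calc (1 - cutoff N x) * |f x| ≤ (1 - cutoff N x) * (c * (1 + ‖x‖ ^ k)) := by gcongr; exact hc x
    _ ≤ (1 - cutoff N x) * (N * δ * (1 + ‖x‖ ^ k)) := by gcongr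
    _ = δ * (((1 - cutoff N x) * N) * (1 + ‖x‖ ^ k)) := by ring
    _ ≤ δ * (‖x‖ * (1 + ‖x‖ ^ k)) := by gcongr
    _ = δ * (‖x‖ ^ 1 + ‖x‖ ^ (k + 1)) := by ring

theorem tendsto_integral_of_forall_isBoundedLipschitz {μs : ℕ → Measure E} {m : Measure E}
    [hμs : ∀ n, IsProbabilityMeasure (μs n)] [hm : IsProbabilityMeasure m]
    (h : ∀ g : E → ℝ, IsBoundedLipschitz g →
      Tendsto (fun n => ∫ x, g x ∂μs n) atTop (𝓝 (∫ x, g x ∂m)))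
    {g : E → ℝ} (hg : Continuous g) (hB : ∃ B, ∀ x, |g x| ≤ B) :
    Tendsto (fun n => ∫ x, g x ∂μs n) atTop (𝓝 (∫ x, g x ∂m)) := by
  obtain ⟨B, hB⟩ := hB
  let ps : ℕ → ProbabilityMeasure E := fun n => ⟨μs n, hμs n⟩
  let p : ProbabilityMeasure E := ⟨m, hm⟩
  have ht : Tendsto ps atTop (𝓝 p) := by
    refine tendsto_iff_forall_lipschitz_integral_tendsto.2 fun f hfb hfl => h f ⟨?_, hfl⟩
    -- The constant bounds the oscillation of `f`; anchoring at 0 turns it into a bound on `|f|`.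
    obtain ⟨C, hC⟩ := hfb
    refine ⟨|f 0| + C, fun x => ?_⟩
    have := hC x 0
    rw [Real.dist_eq] at this
    calc |f x| = |f 0 + (f x - f 0)| := by ring_nf
      _ ≤ |f 0| + |f x - f 0| := abs_add_le _ _
      _ ≤ _ := by gcongr
  exact ProbabilityMeasure.tendsto_iff_forall_integral_tendsto.1 ht
    (BoundedContinuousFunction.ofNormedAddCommGroup g hg B hB)

/-- Probability measures with the same integrals of bounded Lipschitz functions are equal. -/
theorem ext_of_forall_isBoundedLipschitz {m m' : Measure E}
    [IsProbabilityMeasure m] [IsProbabilityMeasure m']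
    (h : ∀ g : E → ℝ, IsBoundedLipschitz g → ∫ x, g x ∂m = ∫ x, g x ∂m') : m = m' := by
  refine ext_of_forall_integral_eq_of_IsFiniteMeasure fun g => ?_
  have := tendsto_integral_of_forall_isBoundedLipschitz (μs := fun _ => m) (m := m')
    (fun g hg => by simp [h g hg]) g.continuous ⟨‖g‖, g.norm_coe_le_norm⟩
  exact tendsto_nhds_unique tendsto_const_nhds this

/-- There is a countable family of bounded Lipschitz functions which, given bounds on all moments,
determines the convergence of the integrals of all continuous functions of polynomial growth. -/
theorem exists_countable_determining (E : Type*) [NormedAddCommGroup E] [ProperSpace E]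
    [SecondCountableTopology E] [MeasurableSpace E] [BorelSpace E] :
    ∃ g : ℕ → ℕ → E → ℝ, (∀ i j, IsBoundedLipschitz (g i j)) ∧
      ∀ (μs : ℕ → Measure E) (m : Measure E), (∀ n, HasMoments (μs n)) → HasMoments m →
        (∀ k : ℕ, ∃ M : ℝ, ∀ n, ∫ x, ‖x‖ ^ k ∂μs n ≤ M) →
        (∀ i j, Tendsto (fun n => ∫ x, g i j x ∂μs n) atTop (𝓝 (∫ x, g i j x ∂m))) →
        ∀ f : E → ℝ, IsCPol f →
          Tendsto (fun n => ∫ x, f x ∂μs n) atTop (𝓝 (∫ x, f x ∂m)) := by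
  -- The compact-open topology on C(E, ℝ) is second countable, so this subset has a countable dense
  -- sequence. Density gives uniform approximation on compact sets only; the cutoffs and the moment
  -- bounds handle the rest of the space.
  let S : Set C(E, ℝ) := {g | IsBoundedLipschitz g}
  have h0 : IsBoundedLipschitz (0 : E → ℝ) :=
    ⟨⟨0, fun x => by simp⟩, 0, LipschitzWith.const 0⟩
  have : Nonempty S := ⟨⟨0, h0⟩⟩
  let d : ℕ → S := TopologicalSpace.denseSeq S
  refine ⟨fun i N x => cutoff N x * (d i : C(E, ℝ)) x, fun i N => (d i).2.cutoff_mul N, ?_⟩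
  intro μs m hμs hm hM ht f hf
  have hp := fun n => (hμs n).isProbabilityMeasure
  have hpm := hm.isProbabilityMeasure
  refine tendsto_integral_of_isCPol hμs hm hM (fun g hg hB => ?_) hf
  refine tendsto_integral_of_forall_isBoundedLipschitz (fun h hh => ?_) hg hB
  obtain ⟨B, hB⟩ := hh.1
  have hB0 : 0 ≤ B := (abs_nonneg _).trans (hB 0)
  obtain ⟨M, hM⟩ := hM 1
  have hi : ∀ {ν : Measure E}, HasMoments ν → Integrable (fun x => 1 + ‖x‖ ^ 1) ν := by
    intro ν hν
    have := hν.isProbabilityMeasure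
    exact (integrable_const 1).add (hν.integrable_norm_pow 1)
  refine tendsto_integral_of_approx (w := fun x => 1 + ‖x‖ ^ 1)
    (M := max (1 + M) (∫ x, 1 + ‖x‖ ^ 1 ∂m)) (fun n => hh.integrable _) (hh.integrable _)
    (fun n => hi (hμs n)) (hi hm) (fun n => ?_) (le_max_right _ _) fun δ hδ => ?_
  · rw [integral_add (integrable_const 1) ((hμs n).integrable_norm_pow 1)]
    simpa using Or.inl (hM n)
  obtain ⟨N, hN⟩ := exists_nat_gt (B / δ)
  rw [div_lt_iff₀ hδ] at hN
  -- The ball of radius N + 1 contains the support of the cutoff and is compact because `E` is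
  -- proper.
  have hd : ∃ i, ∀ x, ‖x‖ ≤ N + 1 → |h x - (d i : C(E, ℝ)) x| < δ := by
    let h' : S := ⟨⟨h, hh.continuous⟩, hh⟩
    have hK : IsCompact (Metric.closedBall (0 : E) (N + 1)) := isCompact_closedBall _ _
    have hopen : Tendsto (fun s : S => (s : C(E, ℝ))) (𝓝 h') (𝓝 (h' : C(E, ℝ))) :=
      continuous_subtype_val.tendsto h'
    have hu := (ContinuousMap.tendsto_iff_forall_isCompact_tendstoUniformlyOn.1 hopen) _ hK
    have hev := Metric.tendstoUniformlyOn_iff.1 hu δ hδ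
    obtain ⟨s, hs, hs'⟩ := (TopologicalSpace.denseRange_denseSeq S).inter_nhds_nonempty hev
    obtain ⟨i, rfl⟩ := hs
    exact ⟨i, fun x hx => by
      have := hs' x (by simpa using hx)
      rwa [Real.dist_eq] at this⟩
  obtain ⟨i, hi'⟩ := hd
  have hbl := (d i).2.cutoff_mul N
  refine ⟨_, fun n => hbl.integrable _, hbl.integrable _, fun x => ?_, ht i N⟩
  have h1 := one_sub_cutoff_mul_le N x
  have h2 : 0 ≤ 1 - cutoff N x := by linarith [cutoff_le_one N x]
  have h3 : cutoff N x * |h x - (d i : C(E, ℝ)) x| ≤ δ := by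
    rcases le_total ((N : ℝ) + 1) ‖x‖ with h' | h'
    · rw [cutoff_eq_zero h', zero_mul]; positivity
    · nlinarith [hi' x h', cutoff_nonneg N x, cutoff_le_one N x,
        abs_nonneg (h x - (d i : C(E, ℝ)) x)]
  calc |h x - cutoff N x * (d i : C(E, ℝ)) x|
      = |(1 - cutoff N x) * h x + cutoff N x * (h x - (d i : C(E, ℝ)) x)| := by ring_nf
    _ ≤ |(1 - cutoff N x) * h x| + |cutoff N x * (h x - (d i : C(E, ℝ)) x)| := abs_add_le _ _
    _ = (1 - cutoff N x) * |h x| + cutoff N x * |h x - (d i : C(E, ℝ)) x| := by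
        rw [abs_mul, abs_mul, abs_of_nonneg h2, abs_of_nonneg (cutoff_nonneg N x)]
    _ ≤ (1 - cutoff N x) * (N * δ) + δ := by
        gcongr
        exact (hB x).trans hN.le
    _ = δ * ((1 - cutoff N x) * N) + δ := by ring
    _ ≤ δ * ‖x‖ + δ := by gcongr
    _ = δ * (1 + ‖x‖ ^ 1) := by ring

/-! ### Empirical measures -/

/-- The empirical measure of a family of observations. -/
noncomputable def empirical (I : Finset ℕ) (z : ℕ → E) : Measure E :=
  ∑ i ∈ I, (I.card : ℝ≥0∞)⁻¹ • Measure.dirac (z i)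

theorem integrable_empirical {I : Finset ℕ} (hI : I.Nonempty) (z : ℕ → E) (f : E → ℝ) :
    Integrable f (empirical I z) := by
  rw [empirical, integrable_finsetSum_measure]
  intro i _
  refine Integrable.smul_measure (integrable_dirac (by simp)) ?_
  simp [hI.ne_empty]

theorem integral_empirical {I : Finset ℕ} (hI : I.Nonempty) (z : ℕ → E) (f : E → ℝ) :
    ∫ x, f x ∂empirical I z = average I z f := by
  rw [empirical, integral_finsetSum_measure]
  · simp [average, integral_smul_measure, Finset.mul_sum]
  · intro i _
    refine Integrable.smul_measure (integrable_dirac (by simp)) ?_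
    simp [hI.ne_empty]

theorem hasMoments_empirical {I : Finset ℕ} (hI : I.Nonempty) (z : ℕ → E) :
    HasMoments (empirical I z) where
  isProbabilityMeasure := by
    constructor
    simp only [empirical, Measure.coe_finsetSum, Finset.sum_apply, Measure.smul_apply,
      measure_univ, smul_eq_mul, mul_one, Finset.sum_const, nsmul_eq_mul]
    exact ENNReal.mul_inv_cancel (by simp [hI.ne_empty]) (by simp)
  integrable_norm_pow k := integrable_empirical hI z _

end Determining

/-! ### Weak limits under bounds on all moments -/

/-- Markov's inequality: the mass beyond radius r is at most M / r. -/
theorem isTightMeasureSet_of_integral_norm_le {S : Set (Measure ℝ)} {M : ℝ}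
    (hS : ∀ μ ∈ S, HasMoments μ) (hM : ∀ μ ∈ S, ∫ x, ‖x‖ ^ 1 ∂μ ≤ M) :
    IsTightMeasureSet S := by
  refine isTightMeasureSet_of_tendsto_measure_norm_gt ?_
  have h0 : Tendsto (fun r : ℝ => ENNReal.ofReal (M / r)) atTop (𝓝 0) := by
    rw [← ENNReal.ofReal_zero]
    exact (ENNReal.continuous_ofReal.tendsto 0).comp (tendsto_const_nhds.div_atTop tendsto_id)
  refine tendsto_of_tendsto_of_tendsto_of_le_of_le' tendsto_const_nhds h0
    (Eventually.of_forall fun _ => zero_le) ?_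
  filter_upwards [eventually_gt_atTop 0] with r hr
  refine iSup₂_le fun μ hμ => ?_
  have := (hS μ hμ).isProbabilityMeasure
  have h1 := mul_meas_ge_le_integral_of_nonneg (μ := μ) (f := fun x : ℝ => ‖x‖ ^ 1)
    (ae_of_all _ fun x => by positivity) ((hS μ hμ).integrable_norm_pow 1) r
  have h2 : μ.real {x | r < ‖x‖} ≤ M / r := by
    rw [le_div_iff₀ hr, mul_comm]
    refine le_trans ?_ (h1.trans (hM μ hμ))
    refine mul_le_mul_of_nonneg_left (measureReal_mono fun x hx => ?_) hr.le
    simp only [Set.mem_ofPred_eq, pow_one] at hx ⊢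
    exact hx.le
  rw [← ENNReal.ofReal_toReal (measure_ne_top μ _)]
  exact ENNReal.ofReal_le_ofReal h2

/-- Fatou's lemma applied to the truncations, which are eventually equal to `f` at each point. -/
theorem integrable_of_forall_integral_min_le {E : Type*} [MeasurableSpace E] {m : Measure E}
    [IsFiniteMeasure m] {f : E → ℝ} (hf : Measurable f) (hf0 : ∀ x, 0 ≤ f x) {M : ℝ}
    (h : ∀ R : ℕ, ∫ x, min (f x) R ∂m ≤ M) : Integrable f m := by
  refine ⟨hf.aestronglyMeasurable, ?_⟩
  rw [hasFiniteIntegral_iff_ofReal (ae_of_all _ hf0)]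
  have hle : ∫⁻ x, ENNReal.ofReal (f x) ∂m
      ≤ ∫⁻ x, liminf (fun R : ℕ => ENNReal.ofReal (min (f x) R)) atTop ∂m := by
    refine lintegral_mono fun x => ?_
    have : Tendsto (fun R : ℕ => ENNReal.ofReal (min (f x) R)) atTop
        (𝓝 (ENNReal.ofReal (f x))) := by
      obtain ⟨N, hN⟩ := exists_nat_ge (f x)
      refine tendsto_const_nhds.congr' ?_
      filter_upwards [eventually_ge_atTop N] with R hR
      rw [min_eq_left (hN.trans (by exact_mod_cast hR))]
    exact this.liminf_eq.ge
  have hm : ∀ R : ℕ, Measurable fun x => min (f x) (R : ℝ) := fun R => hf.min measurable_const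
  refine (hle.trans (lintegral_liminf_le fun R => (hm R).ennreal_ofReal)).trans_lt ?_
  refine lt_of_le_of_lt (b := ENNReal.ofReal M) ?_ ENNReal.ofReal_lt_top
  refine liminf_le_of_le (by isBoundedDefault) fun b hb => ?_
  obtain ⟨R, hR⟩ := hb.exists
  refine hR.trans ?_
  have h0 : ∀ x, 0 ≤ min (f x) (R : ℝ) := fun x => le_min (hf0 x) (by positivity)
  rw [← ofReal_integral_eq_lintegral_ofReal _ (ae_of_all _ h0)]
  · exact ENNReal.ofReal_le_ofReal (h R)
  · refine Integrable.of_bound (hm R).aestronglyMeasurable R (ae_of_all _ fun x => ?_)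
    rw [Real.norm_eq_abs, abs_of_nonneg (h0 x)]
    exact min_le_right _ _

/-- Prokhorov's theorem provides a cluster point, and the assumed convergence of the integrals makes
it the limit of the whole sequence. Truncated moments pass to the limit, so it has all moments. -/
theorem exists_hasMoments_of_tendsto {μs : ℕ → Measure ℝ} (hμs : ∀ n, HasMoments (μs n))
    (hM : ∀ k : ℕ, ∃ M : ℝ, ∀ n, ∫ x, ‖x‖ ^ k ∂μs n ≤ M)
    (h : ∀ g : ℝ → ℝ, IsBoundedLipschitz g →
      ∃ l : ℝ, Tendsto (fun n => ∫ x, g x ∂μs n) atTop (𝓝 l)) :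
    ∃ μ : Measure ℝ, HasMoments μ ∧ ∀ g : ℝ → ℝ, IsBoundedLipschitz g →
      Tendsto (fun n => ∫ x, g x ∂μs n) atTop (𝓝 (∫ x, g x ∂μ)) := by
  let ps : ℕ → ProbabilityMeasure ℝ := fun n => ⟨μs n, (hμs n).isProbabilityMeasure⟩
  obtain ⟨M₁, hM₁⟩ := hM 1
  have ht : IsTightMeasureSet {((p : ProbabilityMeasure ℝ) : Measure ℝ) | p ∈ Set.range ps} := by
    refine isTightMeasureSet_of_integral_norm_le (M := M₁) ?_ ?_
    · rintro _ ⟨_, ⟨n, rfl⟩, rfl⟩; exact hμs n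
    · rintro _ ⟨_, ⟨n, rfl⟩, rfl⟩; exact hM₁ n
  have hK := isCompact_closure_of_isTightMeasureSet ht
  -- A nonprincipal ultrafilter replaces the extraction of a subsequence.
  obtain ⟨p, -, hp⟩ := hK.ultrafilter_le_nhds ((hyperfilter ℕ).map ps) (by
    rw [le_principal_iff]
    exact mem_map.2 (univ_mem' fun n => subset_closure ⟨n, rfl⟩))
  have hp' : Tendsto ps (hyperfilter ℕ : Filter ℕ) (𝓝 p) := hp
  rw [ProbabilityMeasure.tendsto_iff_forall_integral_tendsto] at hp'
  have hlim : ∀ g : ℝ → ℝ, Continuous g → (∃ B, ∀ x, |g x| ≤ B) →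
      Tendsto (fun n => ∫ x, g x ∂μs n) (hyperfilter ℕ : Filter ℕ) (𝓝 (∫ x, g x ∂(p : Measure ℝ)))
      := fun g hg ⟨B, hB⟩ => hp' (BoundedContinuousFunction.ofNormedAddCommGroup g hg B hB)
  refine ⟨p, ⟨inferInstance, fun k => ?_⟩, fun g hg => ?_⟩
  · obtain ⟨M, hM⟩ := hM k
    refine integrable_of_forall_integral_min_le (M := M) (by fun_prop) (fun x => by positivity) ?_
    intro R
    refine le_of_tendsto (hlim (fun x => min (‖x‖ ^ k) R) (by fun_prop)
      ⟨R, fun x => ?_⟩) (Eventually.of_forall fun n => ?_)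
    · rw [abs_of_nonneg (le_min (by positivity) (by positivity))]
      exact min_le_right _ _
    · have := (hμs n).isProbabilityMeasure
      refine le_trans (integral_mono_of_nonneg (ae_of_all _ fun x => ?_)
        ((hμs n).integrable_norm_pow k) (ae_of_all _ fun x => min_le_left _ _)) (hM n)
      exact le_min (by positivity) (by positivity)
  · obtain ⟨l, hl⟩ := h g hg
    have := tendsto_nhds_unique (hl.mono_left Nat.hyperfilter_le_atTop) (hlim g hg.continuous hg.1)
    rwa [← this]

/-! ### Contracting bifurcating dynamics -/

/-- Given the type `x` of the mother and the noise `e`, the types of the two daughters are the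
components of `G x e`. The map `G` is a contraction of the type, and the daughters of `0` have
finite moments of all orders when the noise has law `lam`. -/
structure IsContracting {V : Type*} [MeasurableSpace V] (G : ℝ → V → ℝ × ℝ) (a : ℝ)
    (lam : Measure V) : Prop where
  nonneg : 0 ≤ a
  lt_one : a < 1
  measurable : Measurable fun p : ℝ × V => G p.1 p.2
  norm_sub_le : ∀ x y e, ‖G x e - G y e‖ ≤ a * |x - y|
  integrable_norm_pow : ∀ k : ℕ, Integrable (fun e => ‖G 0 e‖ ^ k) lam

/-- The transition operator of the chain which moves to a uniformly chosen daughter. -/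
noncomputable def meanOp {V : Type*} [MeasurableSpace V] (G : ℝ → V → ℝ × ℝ) (lam : Measure V)
    (g : ℝ → ℝ) (x : ℝ) : ℝ := ∫ e, (g (G x e).1 + g (G x e).2) / 2 ∂lam

/-- `g` is bounded by `B` and `L`-Lipschitz. -/
def IsBLWith (B L : ℝ) (g : ℝ → ℝ) : Prop :=
  (∀ x, |g x| ≤ B) ∧ ∀ x y, |g x - g y| ≤ L * |x - y|

theorem IsBLWith.isBoundedLipschitz {B L : ℝ} {g : ℝ → ℝ} (h : IsBLWith B L g) :
    IsBoundedLipschitz g := by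
  refine ⟨⟨B, h.1⟩, L.toNNReal, LipschitzWith.of_dist_le_mul fun x y => ?_⟩
  rw [Real.dist_eq, Real.dist_eq]
  refine (h.2 x y).trans ?_
  gcongr
  exact Real.le_coe_toNNReal L

theorem IsBoundedLipschitz.exists_isBLWith {g : ℝ → ℝ} (h : IsBoundedLipschitz g) :
    ∃ B L, 0 ≤ L ∧ IsBLWith B L g := by
  obtain ⟨⟨B, hB⟩, L, hL⟩ := h
  exact ⟨B, L, L.2, hB, fun x y => by simpa [Real.dist_eq] using hL.dist_le_mul x y⟩

theorem IsBLWith.continuous {B L : ℝ} {g : ℝ → ℝ} (h : IsBLWith B L g) : Continuous g :=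
  h.isBoundedLipschitz.continuous

section Contracting

variable {V : Type*} [MeasurableSpace V] {G : ℝ → V → ℝ × ℝ} {a : ℝ} {lam : Measure V}

theorem IsContracting.fst_sub_le (hG : IsContracting G a lam) (x y : ℝ) (e : V) :
    |(G x e).1 - (G y e).1| ≤ a * |x - y| :=
  (norm_fst_le (G x e - G y e)).trans (hG.norm_sub_le x y e)

theorem IsContracting.snd_sub_le (hG : IsContracting G a lam) (x y : ℝ) (e : V) :
    |(G x e).2 - (G y e).2| ≤ a * |x - y| :=
  (norm_snd_le (G x e - G y e)).trans (hG.norm_sub_le x y e)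

theorem IsContracting.norm_le (hG : IsContracting G a lam) (x : ℝ) (e : V) :
    ‖G x e‖ ≤ a * |x| + ‖G 0 e‖ := by
  have := hG.norm_sub_le x 0 e
  rw [sub_zero] at this
  calc ‖G x e‖ = ‖(G x e - G 0 e) + G 0 e‖ := by rw [sub_add_cancel]
    _ ≤ ‖G x e - G 0 e‖ + ‖G 0 e‖ := norm_add_le _ _
    _ ≤ _ := by gcongr

theorem IsContracting.measurable_apply (hG : IsContracting G a lam) (x : ℝ) : Measurable (G x) :=
  hG.measurable.comp measurable_prodMk_left

/-- The drift inequality. It controls both the moments of the chain and the empirical moments along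
the tree. -/
theorem IsContracting.exists_norm_pow_le (hG : IsContracting G a lam) {k : ℕ} (hk : k ≠ 0) :
    ∃ b C : ℝ, 0 ≤ b ∧ b < 1 ∧ 0 ≤ C ∧
      ∀ x e, ‖G x e‖ ^ k ≤ b * ‖x‖ ^ k + C * ‖G 0 e‖ ^ k := by
  obtain ⟨b, C, hb0, hb1, hC, h⟩ := mul_add_pow_le hG.nonneg hG.lt_one hk
  refine ⟨b, C, hb0, hb1, hC, fun x e => ?_⟩
  refine le_trans ?_ (h ‖x‖ ‖G 0 e‖ (norm_nonneg _) (norm_nonneg _))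
  gcongr
  exact hG.norm_le x e

theorem IsContracting.integrable_comp [IsProbabilityMeasure lam] (hG : IsContracting G a lam)
    {g : ℝ → ℝ} (hg : Measurable g) {B : ℝ} (hB : ∀ x, |g x| ≤ B) (x : ℝ) :
    Integrable (fun e => (g (G x e).1 + g (G x e).2) / 2) lam := by
  have := hG.measurable_apply x
  refine Integrable.of_bound (C := B) (by fun_prop) (ae_of_all _ fun e => ?_)
  rw [Real.norm_eq_abs, abs_le]
  have h1 := abs_le.1 (hB (G x e).1)
  have h2 := abs_le.1 (hB (G x e).2)
  constructor <;> linarith [h1.1, h1.2, h2.1, h2.2]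

/-- Couple the daughters of x and of y through the same noise: they are within a|x - y| of each
other, so averaging g multiplies its Lipschitz constant by a. -/
theorem IsBLWith.meanOp [IsProbabilityMeasure lam] (hG : IsContracting G a lam) {B L : ℝ}
    (hL : 0 ≤ L) {g : ℝ → ℝ} (h : IsBLWith B L g) : IsBLWith B (L * a) (meanOp G lam g) := by
  have hi := hG.integrable_comp h.continuous.measurable h.1
  refine ⟨fun x => ?_, fun x y => ?_⟩
  · have := norm_integral_le_of_norm_le_const (μ := lam) (C := B)
      (f := fun e => (g (G x e).1 + g (G x e).2) / 2) (ae_of_all _ fun e => by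
        rw [Real.norm_eq_abs, abs_le]
        have h1 := abs_le.1 (h.1 (G x e).1)
        have h2 := abs_le.1 (h.1 (G x e).2)
        constructor <;> linarith [h1.1, h1.2, h2.1, h2.2])
    simpa [BAR.meanOp] using this
  · rw [BAR.meanOp, BAR.meanOp, ← integral_sub (hi x) (hi y)]
    have := norm_integral_le_of_norm_le_const (μ := lam) (C := L * a * |x - y|)
      (f := fun e => (g (G x e).1 + g (G x e).2) / 2 - (g (G y e).1 + g (G y e).2) / 2)
      (ae_of_all _ fun e => by
        have h1 := (h.2 (G x e).1 (G y e).1).trans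
          (mul_le_mul_of_nonneg_left (hG.fst_sub_le x y e) hL)
        have h2 := (h.2 (G x e).2 (G y e).2).trans
          (mul_le_mul_of_nonneg_left (hG.snd_sub_le x y e) hL)
        rw [abs_le] at h1 h2
        rw [Real.norm_eq_abs, abs_le]
        constructor <;> linarith [h1.1, h1.2, h2.1, h2.2])
    simpa using this

theorem IsBLWith.iterate_meanOp [IsProbabilityMeasure lam] (hG : IsContracting G a lam) {B L : ℝ}
    (hL : 0 ≤ L) {g : ℝ → ℝ} (h : IsBLWith B L g) (k : ℕ) :
    IsBLWith B (L * a ^ k) ((BAR.meanOp G lam)^[k] g) := by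
  induction k with
  | zero => simpa using h
  | succ k ih =>
    rw [Function.iterate_succ_apply', pow_succ, ← mul_assoc]
    exact ih.meanOp hG (mul_nonneg hL (pow_nonneg hG.nonneg k))

/-- Applied to the k-th iterate, with Lipschitz constant L a^k, it makes the increments of Q^k g(0)
geometric. -/
theorem IsBLWith.abs_meanOp_zero_sub_le [IsProbabilityMeasure lam] (hG : IsContracting G a lam)
    {B L : ℝ} (hL : 0 ≤ L) {g : ℝ → ℝ} (h : IsBLWith B L g) :
    |BAR.meanOp G lam g 0 - g 0| ≤ L * ∫ e, ‖G 0 e‖ ^ 1 ∂lam := by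
  have hi := hG.integrable_comp h.continuous.measurable h.1 0
  have h0 : g 0 = ∫ _, g 0 ∂lam := by simp
  rw [BAR.meanOp, h0, ← integral_sub hi (integrable_const _), ← integral_const_mul]
  refine (abs_integral_le_integral_abs).trans (integral_mono (hi.sub (integrable_const _)).abs
    ((hG.integrable_norm_pow 1).const_mul L) fun e => ?_)
  have h1 := (h.2 (G 0 e).1 0).trans
    (mul_le_mul_of_nonneg_left ((sub_zero (G 0 e).1).symm ▸ norm_fst_le (G 0 e)) hL)
  have h2 := (h.2 (G 0 e).2 0).trans
    (mul_le_mul_of_nonneg_left ((sub_zero (G 0 e).2).symm ▸ norm_snd_le (G 0 e)) hL)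
  rw [abs_le] at h1 h2
  simp only [pow_one]
  rw [abs_le]
  constructor <;> linarith [h1.1, h1.2, h2.1, h2.2]

/-- The values at 0 form a Cauchy sequence with geometric increments; the value at x differs from
that at 0 by at most L a^k |x|, so the limit does not depend on x. -/
theorem IsBoundedLipschitz.exists_tendsto_iterate_meanOp [IsProbabilityMeasure lam]
    (hG : IsContracting G a lam) {g : ℝ → ℝ} (hg : IsBoundedLipschitz g) :
    ∃ l : ℝ, ∀ x, Tendsto (fun k => (BAR.meanOp G lam)^[k] g x) atTop (𝓝 l) := by
  obtain ⟨B, L, hL, h⟩ := hg.exists_isBLWith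
  have hc : CauchySeq fun k => (BAR.meanOp G lam)^[k] g 0 := by
    refine cauchySeq_of_le_geometric a (L * ∫ e, ‖G 0 e‖ ^ 1 ∂lam) hG.lt_one fun k => ?_
    have := (h.iterate_meanOp hG hL k).abs_meanOp_zero_sub_le hG
      (mul_nonneg hL (pow_nonneg hG.nonneg k))
    rw [dist_comm, Real.dist_eq, Function.iterate_succ_apply']
    linarith
  obtain ⟨l, hl⟩ := cauchySeq_tendsto_of_complete hc
  refine ⟨l, fun x => ?_⟩
  have hd : Tendsto (fun k => (BAR.meanOp G lam)^[k] g x - (BAR.meanOp G lam)^[k] g 0) atTop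
      (𝓝 0) := by
    have h0 : Tendsto (fun k => L * a ^ k * |x|) atTop (𝓝 0) := by
      simpa using ((tendsto_pow_atTop_nhds_zero_of_lt_one hG.nonneg hG.lt_one).const_mul
        L).mul_const |x|
    refine squeeze_zero_norm (fun k => ?_) h0
    simpa using (h.iterate_meanOp hG hL k).2 x 0
  simpa using hd.add hl

end Contracting

/-! ### Existence and uniqueness of the stationary distribution -/

section Stationary

variable {V : Type*} [MeasurableSpace V] {G : ℝ → V → ℝ × ℝ} {a : ℝ} {lam : Measure V}

/-- The law of a uniformly chosen daughter of a mother whose type has law `μ`. -/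
noncomputable def stepLaw (G : ℝ → V → ℝ × ℝ) (lam : Measure V) (μ : Measure ℝ) : Measure ℝ :=
  (2⁻¹ : ℝ≥0∞) • ((μ.prod lam).map (fun p => (G p.1 p.2).1) +
    (μ.prod lam).map fun p => (G p.1 p.2).2)

theorem IsContracting.isProbabilityMeasure_stepLaw [IsProbabilityMeasure lam]
    (hG : IsContracting G a lam) (μ : Measure ℝ) [IsProbabilityMeasure μ] :
    IsProbabilityMeasure (stepLaw G lam μ) := by
  have h1 : IsProbabilityMeasure ((μ.prod lam).map (fun p => (G p.1 p.2).1)) :=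
    Measure.isProbabilityMeasure_map hG.measurable.fst.aemeasurable
  have h2 : IsProbabilityMeasure ((μ.prod lam).map (fun p => (G p.1 p.2).2)) :=
    Measure.isProbabilityMeasure_map hG.measurable.snd.aemeasurable
  constructor
  rw [stepLaw, Measure.smul_apply, Measure.add_apply, measure_univ, measure_univ, smul_eq_mul,
    one_add_one_eq_two, ENNReal.inv_mul_cancel (by simp) (by simp)]

theorem IsContracting.integrable_stepLaw (hG : IsContracting G a lam) {μ : Measure ℝ} {f : ℝ → ℝ}
    (hf : Measurable f) (h1 : Integrable (fun p => f (G p.1 p.2).1) (μ.prod lam))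
    (h2 : Integrable (fun p => f (G p.1 p.2).2) (μ.prod lam)) : Integrable f (stepLaw G lam μ) := by
  refine Integrable.smul_measure (Integrable.add_measure ?_ ?_) (by simp)
  · rwa [integrable_map_measure hf.aestronglyMeasurable hG.measurable.fst.aemeasurable]
  · rwa [integrable_map_measure hf.aestronglyMeasurable hG.measurable.snd.aemeasurable]

theorem IsContracting.integral_stepLaw (hG : IsContracting G a lam) {μ : Measure ℝ} {f : ℝ → ℝ}
    (hf : Measurable f) (h1 : Integrable (fun p => f (G p.1 p.2).1) (μ.prod lam))
    (h2 : Integrable (fun p => f (G p.1 p.2).2) (μ.prod lam)) :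
    ∫ x, f x ∂stepLaw G lam μ
      = ∫ p, (f (G p.1 p.2).1 + f (G p.1 p.2).2) / 2 ∂(μ.prod lam) := by
  rw [stepLaw, integral_smul_measure, integral_add_measure, integral_map, integral_map,
    integral_div, integral_add h1 h2]
  · simp; ring
  · exact hG.measurable.snd.aemeasurable
  · exact hf.aestronglyMeasurable
  · exact hG.measurable.fst.aemeasurable
  · exact hf.aestronglyMeasurable
  · rwa [integrable_map_measure hf.aestronglyMeasurable hG.measurable.fst.aemeasurable]
  · rwa [integrable_map_measure hf.aestronglyMeasurable hG.measurable.snd.aemeasurable]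

/-- The types of a mother and of her daughters. -/
def triangleMap (G : ℝ → V → ℝ × ℝ) (p : ℝ × V) : ℝ × ℝ × ℝ := (p.1, G p.1 p.2)

theorem IsContracting.measurable_triangleMap (hG : IsContracting G a lam) :
    Measurable (triangleMap G) := measurable_fst.prodMk hG.measurable

variable [IsProbabilityMeasure lam]

theorem IsContracting.integral_stepLaw_of_bounded (hG : IsContracting G a lam) {μ : Measure ℝ}
    [IsProbabilityMeasure μ] {f : ℝ → ℝ} (hf : Measurable f) {B : ℝ} (hB : ∀ x, |f x| ≤ B) :
    ∫ x, f x ∂stepLaw G lam μ = ∫ x, meanOp G lam f x ∂μ := by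
  have hm := hG.measurable
  have h1 : Integrable (fun p => f (G p.1 p.2).1) (μ.prod lam) :=
    Integrable.of_bound (C := B) (hf.comp hm.fst).aestronglyMeasurable (ae_of_all _ fun p => hB _)
  have h2 : Integrable (fun p => f (G p.1 p.2).2) (μ.prod lam) :=
    Integrable.of_bound (C := B) (hf.comp hm.snd).aestronglyMeasurable (ae_of_all _ fun p => hB _)
  rw [hG.integral_stepLaw hf h1 h2,
    integral_prod (fun p : ℝ × V => (f (G p.1 p.2).1 + f (G p.1 p.2).2) / 2)
    ((h1.add h2).div_const 2)]
  rfl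

theorem IsContracting.integrable_norm_pow_prod (hG : IsContracting G a lam) {μ : Measure ℝ}
    (hμ : HasMoments μ) (k : ℕ) : Integrable (fun p => ‖G p.1 p.2‖ ^ k) (μ.prod lam) := by
  have := hμ.isProbabilityMeasure
  have hm := hG.measurable
  rcases eq_or_ne k 0 with rfl | hk
  · simp
  obtain ⟨b, C, -, -, -, h⟩ := hG.exists_norm_pow_le hk
  refine (((hμ.integrable_norm_pow k).comp_fst lam).const_mul b |>.add
    (((hG.integrable_norm_pow k).comp_snd μ).const_mul C)).mono' (by fun_prop)
    (ae_of_all _ fun p => ?_)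
  rw [Real.norm_of_nonneg (by positivity)]
  exact h p.1 p.2

theorem IsContracting.hasMoments_stepLaw (hG : IsContracting G a lam) {μ : Measure ℝ}
    (hμ : HasMoments μ) : HasMoments (stepLaw G lam μ) := by
  have := hμ.isProbabilityMeasure
  have hm := hG.measurable
  refine ⟨hG.isProbabilityMeasure_stepLaw μ, fun k => ?_⟩
  refine hG.integrable_stepLaw (by fun_prop) ?_ ?_
  · refine (hG.integrable_norm_pow_prod hμ k).mono' (by fun_prop) (ae_of_all _ fun p => ?_)
    rw [Real.norm_of_nonneg (by positivity)]
    gcongr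
    exact norm_fst_le _
  · refine (hG.integrable_norm_pow_prod hμ k).mono' (by fun_prop) (ae_of_all _ fun p => ?_)
    rw [Real.norm_of_nonneg (by positivity)]
    gcongr
    exact norm_snd_le _

theorem IsContracting.exists_integral_norm_pow_stepLaw_le (hG : IsContracting G a lam) {k : ℕ}
    (hk : k ≠ 0) : ∃ b D : ℝ, 0 ≤ b ∧ b < 1 ∧ ∀ μ : Measure ℝ, HasMoments μ →
      ∫ x, ‖x‖ ^ k ∂stepLaw G lam μ ≤ b * ∫ x, ‖x‖ ^ k ∂μ + D := by
  obtain ⟨b, C, hb0, hb1, -, h⟩ := hG.exists_norm_pow_le hk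
  refine ⟨b, C * ∫ e, ‖G 0 e‖ ^ k ∂lam, hb0, hb1, fun μ hμ => ?_⟩
  have := hμ.isProbabilityMeasure
  have hm := hG.measurable
  have hi := hG.integrable_norm_pow_prod hμ k
  have h1 : Integrable (fun p => ‖(G p.1 p.2).1‖ ^ k) (μ.prod lam) := by
    refine hi.mono' (by fun_prop) (ae_of_all _ fun p => ?_)
    rw [Real.norm_of_nonneg (by positivity)]
    gcongr
    exact norm_fst_le _
  have h2 : Integrable (fun p => ‖(G p.1 p.2).2‖ ^ k) (μ.prod lam) := by
    refine hi.mono' (by fun_prop) (ae_of_all _ fun p => ?_)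
    rw [Real.norm_of_nonneg (by positivity)]
    gcongr
    exact norm_snd_le _
  have i1 : Integrable (fun p : ℝ × V => b * ‖p.1‖ ^ k) (μ.prod lam) :=
    ((hμ.integrable_norm_pow k).comp_fst lam).const_mul b
  have i2 : Integrable (fun p : ℝ × V => C * ‖G 0 p.2‖ ^ k) (μ.prod lam) :=
    ((hG.integrable_norm_pow k).comp_snd μ).const_mul C
  rw [hG.integral_stepLaw (f := fun x => ‖x‖ ^ k) (by fun_prop) h1 h2]
  calc ∫ p, (‖(G p.1 p.2).1‖ ^ k + ‖(G p.1 p.2).2‖ ^ k) / 2 ∂(μ.prod lam)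
      ≤ ∫ p, b * ‖p.1‖ ^ k + C * ‖G 0 p.2‖ ^ k ∂(μ.prod lam) := by
        refine integral_mono ((h1.add h2).div_const 2) (i1.add i2) fun p => ?_
        have e1 : ‖(G p.1 p.2).1‖ ^ k ≤ ‖G p.1 p.2‖ ^ k := by gcongr; exact norm_fst_le _
        have e2 : ‖(G p.1 p.2).2‖ ^ k ≤ ‖G p.1 p.2‖ ^ k := by gcongr; exact norm_snd_le _
        have e3 := h p.1 p.2
        show (‖(G p.1 p.2).1‖ ^ k + ‖(G p.1 p.2).2‖ ^ k) / 2 ≤ _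
        linarith
    _ = b * ∫ x, ‖x‖ ^ k ∂μ + C * ∫ e, ‖G 0 e‖ ^ k ∂lam := by
        rw [integral_add i1 i2, integral_const_mul, integral_const_mul,
          integral_fun_fst (fun x : ℝ => ‖x‖ ^ k), integral_fun_snd (fun e => ‖G 0 e‖ ^ k)]
        simp

theorem hasMoments_dirac (x : ℝ) : HasMoments (Measure.dirac x) :=
  ⟨inferInstance, fun _ => integrable_dirac (by simp)⟩

/-- A contracting bifurcating dynamics has a stationary distribution with finite moments. -/
theorem IsContracting.exists_stepLaw_eq (hG : IsContracting G a lam) :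
    ∃ μ : Measure ℝ, HasMoments μ ∧ stepLaw G lam μ = μ := by
  -- The laws of the chain started at 0. By duality they integrate g to Q^n g(0), which converges,
  -- and the drift inequality bounds their moments.
  let μs : ℕ → Measure ℝ := fun n => (stepLaw G lam)^[n] (Measure.dirac 0)
  have hsucc : ∀ n, μs (n + 1) = stepLaw G lam (μs n) := fun n =>
    Function.iterate_succ_apply' _ _ _
  have hμs : ∀ n, HasMoments (μs n) := by
    intro n
    induction n with
    | zero => exact hasMoments_dirac 0
    | succ n ih => rw [hsucc]; exact hG.hasMoments_stepLaw ih
  have hp := fun n => (hμs n).isProbabilityMeasure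
  have hM : ∀ k : ℕ, ∃ M : ℝ, ∀ n, ∫ x, ‖x‖ ^ k ∂μs n ≤ M := by
    intro k
    rcases eq_or_ne k 0 with rfl | hk
    · exact ⟨1, fun n => by simp⟩
    obtain ⟨b, D, hb0, hb1, h⟩ := hG.exists_integral_norm_pow_stepLaw_le hk
    exact bddAbove_of_contracting (v := fun _ => D) hb0 hb1 (fun _ => le_rfl)
      fun n => by rw [hsucc]; exact h _ (hμs n)
  have hint : ∀ g : ℝ → ℝ, IsBoundedLipschitz g → ∀ n,
      ∫ x, g x ∂μs n = (meanOp G lam)^[n] g 0 := by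
    intro g hg n
    induction n generalizing g with
    | zero => simp [μs]
    | succ n ih =>
      obtain ⟨B, L, hL, h⟩ := hg.exists_isBLWith
      rw [hsucc, hG.integral_stepLaw_of_bounded h.continuous.measurable h.1,
        ih _ (h.meanOp hG hL).isBoundedLipschitz, Function.iterate_succ_apply]
  obtain ⟨μ, hμ, ht⟩ := exists_hasMoments_of_tendsto hμs hM fun g hg => by
    obtain ⟨l, hl⟩ := hg.exists_tendsto_iterate_meanOp hG
    exact ⟨l, by simpa only [hint g hg] using hl 0⟩
  refine ⟨μ, hμ, ?_⟩
  have := hμ.isProbabilityMeasure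
  have := hG.isProbabilityMeasure_stepLaw μ
  refine ext_of_forall_isBoundedLipschitz fun g hg => ?_
  obtain ⟨B, L, hL, h⟩ := hg.exists_isBLWith
  have hg' := (h.meanOp hG hL).isBoundedLipschitz
  rw [hG.integral_stepLaw_of_bounded h.continuous.measurable h.1]
  -- The integral of Q g under the n-th law is that of g under the next one, so both have the same
  -- limit.
  refine tendsto_nhds_unique (ht _ hg') ?_
  have := (ht g hg).comp (tendsto_add_atTop_nat 1)
  refine this.congr fun n => ?_
  simp only [Function.comp_apply]
  rw [hint g hg, hint _ hg', Function.iterate_succ_apply]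

/-- The iterates of the transition operator converge to the integral with respect to any stationary
distribution. -/
theorem IsContracting.tendsto_iterate_meanOp (hG : IsContracting G a lam) {μ : Measure ℝ}
    [IsProbabilityMeasure μ] (hμ : stepLaw G lam μ = μ) {g : ℝ → ℝ} (hg : IsBoundedLipschitz g)
    (x : ℝ) : Tendsto (fun k => (meanOp G lam)^[k] g x) atTop (𝓝 (∫ y, g y ∂μ)) := by
  obtain ⟨l, hl⟩ := hg.exists_tendsto_iterate_meanOp hG
  obtain ⟨B, L, hL, h⟩ := hg.exists_isBLWith
  -- Stationarity makes these integrals constant in k, while dominated convergence sends them to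
  -- `l`; hence `l` is the integral of g.
  have hconst : ∀ k, ∫ y, (meanOp G lam)^[k] g y ∂μ = ∫ y, g y ∂μ := by
    intro k
    induction k with
    | zero => rfl
    | succ k ih =>
      have hk := h.iterate_meanOp hG hL k
      rw [← ih, Function.iterate_succ_apply',
        ← hG.integral_stepLaw_of_bounded hk.continuous.measurable hk.1, hμ]
  have ht : Tendsto (fun k => ∫ y, (meanOp G lam)^[k] g y ∂μ) atTop (𝓝 (∫ _, l ∂μ)) :=
    tendsto_integral_of_dominated_convergence (fun _ => B)
      (fun k => (h.iterate_meanOp hG hL k).continuous.measurable.aestronglyMeasurable)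
      (integrable_const B) (fun k => ae_of_all _ (h.iterate_meanOp hG hL k).1)
      (ae_of_all _ hl)
  simp only [hconst] at ht
  rw [tendsto_nhds_unique tendsto_const_nhds ht]
  simpa using hl x

theorem IsContracting.eq_of_stepLaw_eq (hG : IsContracting G a lam) {μ μ' : Measure ℝ}
    [IsProbabilityMeasure μ] [IsProbabilityMeasure μ'] (hμ : stepLaw G lam μ = μ)
    (hμ' : stepLaw G lam μ' = μ') : μ' = μ :=
  ext_of_forall_isBoundedLipschitz fun _ hg =>
    tendsto_nhds_unique (hG.tendsto_iterate_meanOp hμ' hg 0) (hG.tendsto_iterate_meanOp hμ hg 0)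

/-! ### The stationary law of the mother-daughters triangle -/

theorem IsContracting.hasMoments_triangle (hG : IsContracting G a lam) {μ : Measure ℝ}
    (hμ : HasMoments μ) : HasMoments ((μ.prod lam).map (triangleMap G)) := by
  have := hμ.isProbabilityMeasure
  have hm := hG.measurable_triangleMap
  refine ⟨Measure.isProbabilityMeasure_map hm.aemeasurable, fun k => ?_⟩
  rw [integrable_map_measure (by fun_prop) hm.aemeasurable]
  refine (((hμ.integrable_norm_pow k).comp_fst lam).add
    (hG.integrable_norm_pow_prod hμ k)).mono' (by fun_prop) (ae_of_all _ fun p => ?_)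
  simp only [Function.comp_apply, Pi.add_apply, triangleMap, Prod.norm_mk]
  rw [Real.norm_of_nonneg (by positivity)]
  rcases max_cases ‖p.1‖ ‖G p.1 p.2‖ with ⟨h, -⟩ | ⟨h, -⟩
  · rw [h]; linarith [pow_nonneg (norm_nonneg (G p.1 p.2)) k]
  · rw [h]; linarith [pow_nonneg (norm_nonneg p.1) k]

/-- The conditional expectation of `f` on a triangle given the type of the mother. -/
noncomputable def triangleOp (G : ℝ → V → ℝ × ℝ) (lam : Measure V) (f : ℝ × ℝ × ℝ → ℝ) (x : ℝ) :
    ℝ := ∫ e, f (x, G x e) ∂lam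

theorem IsContracting.integral_triangle (hG : IsContracting G a lam) {μ : Measure ℝ}
    [IsProbabilityMeasure μ] {f : ℝ × ℝ × ℝ → ℝ}
    (hf : Integrable f ((μ.prod lam).map (triangleMap G))) :
    ∫ d, f d ∂(μ.prod lam).map (triangleMap G) = ∫ x, triangleOp G lam f x ∂μ := by
  have hm := hG.measurable_triangleMap
  rw [integral_map hm.aemeasurable hf.aestronglyMeasurable,
    integral_prod (fun p => f (triangleMap G p))
      ((integrable_map_measure hf.aestronglyMeasurable hm.aemeasurable).1 hf)]
  rfl

theorem IsContracting.integrable_triangleOp (hG : IsContracting G a lam) {μ : Measure ℝ}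
    [IsProbabilityMeasure μ] {f : ℝ × ℝ × ℝ → ℝ}
    (hf : Integrable f ((μ.prod lam).map (triangleMap G))) :
    Integrable (triangleOp G lam f) μ :=
  ((integrable_map_measure hf.aestronglyMeasurable
    hG.measurable_triangleMap.aemeasurable).1 hf).integral_prod_left

/-- The triangle of a mother with law δ_x has all moments. -/
theorem IsContracting.integrable_apply_of_isCPol (hG : IsContracting G a lam)
    {f : ℝ × ℝ × ℝ → ℝ} (hf : IsCPol f) (x : ℝ) : Integrable (fun e => f (x, G x e)) lam := by
  have hm := hG.measurable_apply x
  have h := (hG.hasMoments_triangle (hasMoments_dirac x)).integrable hf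
  rw [integrable_map_measure hf.1.measurable.aestronglyMeasurable
    hG.measurable_triangleMap.aemeasurable, Measure.dirac_prod, integrable_map_measure
    (hf.1.measurable.comp hG.measurable_triangleMap).aestronglyMeasurable (by fun_prop)] at h
  exact h

/-- In the sup norm, two triangles with the same noise are at the distance of their mothers because
a < 1, so the Lipschitz constant is preserved. -/
theorem IsBoundedLipschitz.triangleOp (hG : IsContracting G a lam) {f : ℝ × ℝ × ℝ → ℝ}
    (hf : IsBoundedLipschitz f) : IsBoundedLipschitz (BAR.triangleOp G lam f) := by
  have hfc := hf.continuous
  obtain ⟨⟨B, hB⟩, L, hL⟩ := hf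
  have hi : ∀ x, Integrable (fun e => f (x, G x e)) lam := fun x => by
    have := hG.measurable_apply x
    have := hfc.measurable
    exact Integrable.of_bound (C := B) (by fun_prop) (ae_of_all _ fun e => hB _)
  refine ⟨⟨B, fun x => ?_⟩, L, LipschitzWith.of_dist_le_mul fun x y => ?_⟩
  · simpa [BAR.triangleOp] using
      norm_integral_le_of_norm_le_const (μ := lam) (f := fun e => f (x, G x e))
        (ae_of_all _ fun e => hB (x, G x e))
  · rw [Real.dist_eq, BAR.triangleOp, BAR.triangleOp, ← integral_sub (hi x) (hi y)]
    have := norm_integral_le_of_norm_le_const (μ := lam) (C := L * dist x y)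
      (f := fun e => f (x, G x e) - f (y, G y e)) (ae_of_all _ fun e => by
        have h1 := hL.dist_le_mul (x, G x e) (y, G y e)
        rw [Real.dist_eq] at h1
        refine h1.trans ?_
        gcongr
        rw [Prod.dist_eq]
        refine max_le le_rfl ?_
        rw [dist_eq_norm, Real.dist_eq]
        refine (hG.norm_sub_le x y e).trans ?_
        have := hG.lt_one
        nlinarith [abs_nonneg (x - y)])
    simpa using this

end Stationary

/-! ### Tree-indexed processes driven by independent noise -/

/-- The process `Y` on the binary tree follows the dynamics `G` with noise `e` of law `lam`; the
filtration `F` enumerates the vertices, and the noise `e n` is independent of `F n`. -/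
structure IsTreeProcess {Ω V : Type*} {mΩ : MeasurableSpace Ω} [MeasurableSpace V]
    (Pr : Measure Ω) (G : ℝ → V → ℝ × ℝ) (lam : Measure V) (F : Filtration ℕ mΩ)
    (Y : ℕ → Ω → ℝ) (e : ℕ → Ω → V) : Prop where
  daughters : ∀ n, 1 ≤ n → ∀ ω, (Y (2 * n) ω, Y (2 * n + 1) ω) = G (Y n ω) (e n ω)
  measurable_type : ∀ n, 1 ≤ n → Measurable[F n] (Y n)
  measurable_noise : ∀ n, 1 ≤ n → Measurable[F (n + 1)] (e n)
  map_noise : ∀ n, 1 ≤ n → Pr.map (e n) = lam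
  indep : ∀ n, 1 ≤ n → Indep (MeasurableSpace.comap (e n) inferInstance) (F n) Pr

/-- Summable second moments make the sum of the squares almost surely finite, so its terms tend to
0. -/
theorem ae_tendsto_zero_of_integral_sq_le {Ω : Type*} [MeasurableSpace Ω] {Pr : Measure Ω}
    {u : ℕ → Ω → ℝ} (hu : ∀ n, Integrable (fun ω => u n ω ^ 2) Pr) {c : ℕ → ℝ} (hc : Summable c)
    (h : ∀ n, ∫ ω, u n ω ^ 2 ∂Pr ≤ c n) : ∀ᵐ ω ∂Pr, Tendsto (fun n => u n ω) atTop (𝓝 0) := by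
  have hsum : ∑' n, eLpNorm (fun ω => u n ω ^ 2) 1 Pr ≠ ∞ := by
    refine ne_top_of_le_ne_top hc.tsum_ofReal_ne_top (ENNReal.tsum_le_tsum fun n => ?_)
    rw [eLpNorm_one_eq_lintegral_enorm, ← ofReal_integral_norm_eq_lintegral_enorm (hu n)]
    refine ENNReal.ofReal_le_ofReal (le_trans (le_of_eq ?_) (h n))
    refine integral_congr_ae (ae_of_all _ fun ω => ?_)
    exact Real.norm_of_nonneg (sq_nonneg _)
  filter_upwards [summable_norm_of_tsum_eLpNorm_ne_top le_rfl
    (fun n => (hu n).aestronglyMeasurable) hsum] with ω hω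
  refine tendsto_zero_of_summable_sq (hω.congr fun n => ?_)
  exact Real.norm_of_nonneg (sq_nonneg _)

/-- Convergence of the averages over generations for bounded Lipschitz functions, and bounds on the
empirical moments, give the convergence of the averages over generations and subtrees for all
continuous functions of polynomial growth. -/
theorem ae_forall_isCPol_tendsto {Ω : Type*} [MeasurableSpace Ω] {Pr : Measure Ω}
    {E : Type*} [NormedAddCommGroup E] [ProperSpace E]
    [SecondCountableTopology E] [MeasurableSpace E] [BorelSpace E] {Z : Ω → ℕ → E} {m : Measure E}
    (hm : HasMoments m)
    (hM : ∀ᵐ ω ∂Pr, ∀ k : ℕ, ∃ M : ℝ, ∀ q, average (generation q) (Z ω) (fun x => ‖x‖ ^ k) ≤ M)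
    (h : ∀ g : E → ℝ, IsBoundedLipschitz g →
      ∀ᵐ ω ∂Pr, Tendsto (fun q => average (generation q) (Z ω) g) atTop (𝓝 (∫ x, g x ∂m))) :
    ∀ᵐ ω ∂Pr, ∀ f : E → ℝ, IsCPol f →
      Tendsto (fun q => average (generation q) (Z ω) f) atTop (𝓝 (∫ x, f x ∂m)) ∧
      Tendsto (fun r => average (subtree r) (Z ω) f) atTop (𝓝 (∫ x, f x ∂m)) := by
  obtain ⟨g, hg, hdet⟩ := exists_countable_determining E
  -- The null set is fixed here by the countable family, before `f` is introduced.
  filter_upwards [hM, ae_all_iff.2 fun i => ae_all_iff.2 fun j => h (g i j) (hg i j)]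
    with ω hMω hω f hf
  have hint := fun q (f : E → ℝ) => integral_empirical (generation_nonempty q) (Z ω) f
  have := hdet (fun q => empirical (generation q) (Z ω)) m
    (fun q => hasMoments_empirical (generation_nonempty q) _) hm
    (by simpa only [hint] using hMω) (by simpa only [hint] using hω) f hf
  simp only [hint] at this
  exact ⟨this, tendsto_average_subtree this⟩

/-- A power of the sup norm is at most the sum of the powers of the coordinates. The daughters
contribute twice the average over generation q + 1, which has twice as many vertices. -/
theorem bddAbove_average_triangle_norm_pow {y : ℕ → ℝ} {k : ℕ} {M : ℝ}
    (hM : ∀ q, average (generation q) y (fun x => ‖x‖ ^ k) ≤ M) (q : ℕ) :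
    average (generation q) (triangle y) (fun d => ‖d‖ ^ k) ≤ M + 2 * M := by
  have h1 := hM (q + 1)
  rw [average_generation_succ] at h1
  have h2 : average (generation q) (triangle y) (fun d => ‖d‖ ^ k)
      ≤ average (generation q) (triangle y) (fun d => ‖d.1‖ ^ k +
        2 * ((‖d.2.1‖ ^ k + ‖d.2.2‖ ^ k) / 2)) := by
    refine average_mono fun i _ => ?_
    generalize triangle y i = d
    have p1 := pow_nonneg (norm_nonneg d.1) k
    have p2 := pow_nonneg (norm_nonneg d.2.1) k
    have p3 := pow_nonneg (norm_nonneg d.2.2) k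
    rw [Prod.norm_def d, Prod.norm_def d.2]
    rcases max_cases ‖d.1‖ (max ‖d.2.1‖ ‖d.2.2‖) with ⟨h, -⟩ | ⟨h, -⟩ <;> rw [h]
    · linarith
    · rcases max_cases ‖d.2.1‖ ‖d.2.2‖ with ⟨h, -⟩ | ⟨h, -⟩ <;> rw [h] <;> linarith
  rw [average_add, average_const_mul] at h2
  have h3 : average (generation q) (triangle y) (fun d => ‖d.1‖ ^ k)
      = average (generation q) y (fun x => ‖x‖ ^ k) := rfl
  rw [h3] at h2
  linarith [hM q]

/-! ### Almost sure bounds on the empirical moments -/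

section TreeProcess

variable {Ω V : Type*} {mΩ : MeasurableSpace Ω} [MeasurableSpace V] {Pr : Measure Ω}
  {G : ℝ → V → ℝ × ℝ} {a : ℝ} {lam : Measure V} {F : Filtration ℕ mΩ} {Y : ℕ → Ω → ℝ}
  {e : ℕ → Ω → V}

theorem IsTreeProcess.triangle_eq (hY : IsTreeProcess Pr G lam F Y e) {n : ℕ} (hn : 1 ≤ n)
    (ω : Ω) : triangle (fun i => Y i ω) n = triangleMap G (Y n ω, e n ω) := by
  rw [triangle, triangleMap, hY.daughters n hn ω]

theorem IsTreeProcess.indepFun_noise (hY : IsTreeProcess Pr G lam F Y e) {i j : ℕ} (hi : 1 ≤ i)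
    (hij : i < j) : IndepFun (e i) (e j) Pr := by
  rw [IndepFun_iff_Indep]
  exact (indep_of_indep_of_le_right (hY.indep j (hi.trans hij.le))
    (((hY.measurable_noise i hi).mono (F.mono hij) le_rfl).comap_le)).symm

/-- The strong law along the numbering of the vertices, for which pairwise independence suffices,
bounds the averages over initial segments. A generation lies in an initial segment of comparable
size, and `h` is nonnegative. -/
theorem IsTreeProcess.ae_bddAbove_average_noise (hY : IsTreeProcess Pr G lam F Y e) {h : V → ℝ}
    (hm : Measurable h) (h0 : ∀ v, 0 ≤ h v) (hi : Integrable h lam) :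
    ∀ᵐ ω ∂Pr, ∃ M : ℝ, ∀ q, average (generation q) (fun i => e i ω) h ≤ M := by
  have he : ∀ n, Measurable (e (n + 1)) := fun n =>
    (hY.measurable_noise (n + 1) (by omega)).mono (F.le _) le_rfl
  have hmap : ∀ n, Pr.map (e (n + 1)) = lam := fun n => hY.map_noise (n + 1) (by omega)
  have hslln := strong_law_ae_real (μ := Pr) (fun n ω => h (e (n + 1) ω))
    (by
      rw [← hmap 0, integrable_map_measure hm.aestronglyMeasurable (he 0).aemeasurable] at hi
      exact hi)
    (by
      intro i j hij
      rcases lt_or_gt_of_ne hij with h' | h'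
      · exact (hY.indepFun_noise (by omega) (by omega : i + 1 < j + 1)).comp hm hm
      · exact ((hY.indepFun_noise (by omega) (by omega : j + 1 < i + 1)).comp hm hm).symm)
    (fun n => by
      have : IdentDistrib (e (n + 1)) (e (0 + 1)) Pr Pr :=
        ⟨(he n).aemeasurable, (he 0).aemeasurable, by rw [hmap, hmap]⟩
      exact this.comp hm)
  filter_upwards [hslln] with ω hω
  obtain ⟨M, hM⟩ := hω.bddAbove_range
  -- Generation q has 2^q vertices and lies among the first 2^(q + 1), hence the factor 2.
  refine ⟨2 * M, fun q => ?_⟩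
  have h1 := hM ⟨2 ^ (q + 1), rfl⟩
  simp only at h1
  push_cast at h1
  rw [div_le_iff₀ (by positivity)] at h1
  have h2 : ∑ i ∈ generation q, h (e i ω) ≤ ∑ i ∈ Finset.range (2 ^ (q + 1)), h (e (i + 1) ω) := by
    rw [Finset.range_eq_Ico, Finset.sum_Ico_add' (fun i => h (e i ω)) 0 (2 ^ (q + 1)) 1]
    refine Finset.sum_le_sum_of_subset_of_nonneg (fun i hi => ?_) fun i _ _ => h0 _
    have := one_le_of_mem_generation hi
    simp only [generation, Finset.mem_Ico] at hi ⊢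
    omega
  rw [average, card_generation, inv_mul_le_iff₀ (by positivity)]
  push_cast
  calc ∑ i ∈ generation q, h (e i ω) ≤ _ := h2
    _ ≤ M * 2 ^ (q + 1) := h1
    _ = 2 ^ q * (2 * M) := by ring

/-- Averaging the drift inequality over a generation gives u_{q+1} ≤ b u_q + C v_q, where v_q is an
average over the noise, almost surely bounded in q. The bound depends on ω. -/
theorem IsTreeProcess.ae_bddAbove_average_norm_pow (hG : IsContracting G a lam)
    (hY : IsTreeProcess Pr G lam F Y e) :
    ∀ᵐ ω ∂Pr, ∀ k : ℕ, ∃ M : ℝ, ∀ q,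
      average (generation q) (fun i => Y i ω) (fun x => ‖x‖ ^ k) ≤ M := by
  refine ae_all_iff.2 fun k => ?_
  rcases eq_or_ne k 0 with rfl | hk
  · refine ae_of_all _ fun ω => ⟨1, fun q => ?_⟩
    simp only [pow_zero]
    exact (average_const (generation_nonempty q) _ _).le
  obtain ⟨b, C, hb0, hb1, hC, h⟩ := hG.exists_norm_pow_le hk
  have hm := hG.measurable_apply 0
  filter_upwards [hY.ae_bddAbove_average_noise (h := fun v => ‖G 0 v‖ ^ k) (by fun_prop)
    (fun v => by positivity) (hG.integrable_norm_pow k)] with ω ⟨M, hM⟩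
  refine bddAbove_of_contracting
    (v := fun q => C * average (generation q) (fun i => e i ω) fun v => ‖G 0 v‖ ^ k)
    hb0 hb1 (fun q => mul_le_mul_of_nonneg_left (hM q) hC) fun q => ?_
  rw [average_generation_succ, ← average_const_mul, ← average_const_mul]
  simp only [average]
  rw [← mul_add, ← Finset.sum_add_distrib]
  refine mul_le_mul_of_nonneg_left (Finset.sum_le_sum fun i hi => ?_) (by positivity)
  rw [hY.triangle_eq (one_le_of_mem_generation hi), triangleMap]
  have e1 : ‖(G (Y i ω) (e i ω)).1‖ ^ k ≤ ‖G (Y i ω) (e i ω)‖ ^ k := by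
    gcongr; exact norm_fst_le _
  have e2 : ‖(G (Y i ω) (e i ω)).2‖ ^ k ≤ ‖G (Y i ω) (e i ω)‖ ^ k := by
    gcongr; exact norm_snd_le _
  have e3 := h (Y i ω) (e i ω)
  simp only
  linarith

/-! ### Fluctuations around conditional expectations -/

variable [IsProbabilityMeasure lam]

theorem IsContracting.measurable_triangleOp (hG : IsContracting G a lam) {f : ℝ × ℝ × ℝ → ℝ}
    (hf : Measurable f) : Measurable (triangleOp G lam f) :=
  ((hf.comp hG.measurable_triangleMap).stronglyMeasurable.integral_prod_right' (ν := lam)).measurable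

theorem abs_triangleOp_le {f : ℝ × ℝ × ℝ → ℝ} {B : ℝ} (hB : ∀ d, |f d| ≤ B) (x : ℝ) :
    |triangleOp G lam f x| ≤ B := by
  simpa [triangleOp] using
    norm_integral_le_of_norm_le_const (μ := lam) (f := fun e => f (x, G x e))
      (ae_of_all _ fun e => hB (x, G x e))

/-- The fluctuation of `f` on the triangle of vertex `n` around its conditional expectation. -/
noncomputable def fluctuation (G : ℝ → V → ℝ × ℝ) (lam : Measure V) (f : ℝ × ℝ × ℝ → ℝ)
    (Y : ℕ → Ω → ℝ) (n : ℕ) (ω : Ω) : ℝ :=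
  f (triangle (fun i => Y i ω) n) - triangleOp G lam f (Y n ω)

theorem abs_fluctuation_le {f : ℝ × ℝ × ℝ → ℝ} {B : ℝ} (hB : ∀ d, |f d| ≤ B) (n : ℕ) (ω : Ω) :
    |fluctuation G lam f Y n ω| ≤ 2 * B := by
  have h1 := hB (triangle (fun i => Y i ω) n)
  have h2 := abs_triangleOp_le (G := G) (lam := lam) hB (Y n ω)
  calc |fluctuation G lam f Y n ω| ≤ _ := abs_sub _ _
    _ ≤ 2 * B := by linarith

theorem IsTreeProcess.measurable_fluctuation (hG : IsContracting G a lam)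
    (hY : IsTreeProcess Pr G lam F Y e) {f : ℝ × ℝ × ℝ → ℝ} (hf : Measurable f) {n : ℕ}
    (hn : 1 ≤ n) : Measurable[F (n + 1)] (fluctuation G lam f Y n) := by
  have h1 : Measurable[F (n + 1)] (Y n) := (hY.measurable_type n hn).mono (F.mono n.le_succ) le_rfl
  have h2 := hY.measurable_noise n hn
  have h3 : fluctuation G lam f Y n
      = fun ω => f (triangleMap G (Y n ω, e n ω)) - triangleOp G lam f (Y n ω) := by
    ext ω
    rw [fluctuation, hY.triangle_eq hn]
  rw [h3]
  exact (hf.comp (hG.measurable_triangleMap.comp (h1.prodMk h2))).sub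
    ((hG.measurable_triangleOp hf).comp h1)

variable [IsProbabilityMeasure Pr]

/-- The pair (φ, Y n) is known at time n, hence independent of `e n`. By Fubini, integrating the
noise first annihilates the fluctuation. -/
theorem IsTreeProcess.integral_mul_fluctuation (hG : IsContracting G a lam)
    (hY : IsTreeProcess Pr G lam F Y e) {f : ℝ × ℝ × ℝ → ℝ} (hf : Measurable f) {B : ℝ}
    (hB : ∀ d, |f d| ≤ B) {n : ℕ} (hn : 1 ≤ n) {φ : Ω → ℝ} (hφ : Measurable[F n] φ) {K : ℝ}
    (hK : ∀ ω, |φ ω| ≤ K) : ∫ ω, φ ω * fluctuation G lam f Y n ω ∂Pr = 0 := by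
  have hYn := hY.measurable_type n hn
  have hp : Measurable[F n] fun ω => (φ ω, Y n ω) := hφ.prodMk hYn
  have hp' : Measurable fun ω => (φ ω, Y n ω) := hp.mono (F.le n) le_rfl
  have he : Measurable (e n) := (hY.measurable_noise n hn).mono (F.le _) le_rfl
  have hind : IndepFun (fun ω => (φ ω, Y n ω)) (e n) Pr := by
    rw [IndepFun_iff_Indep]
    exact (indep_of_indep_of_le_right (hY.indep n hn) hp.comap_le).symm
  have hmap := (indepFun_iff_map_prod_eq_prod_map_map hp'.aemeasurable he.aemeasurable).1 hind
  rw [hY.map_noise n hn] at hmap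
  let H : (ℝ × ℝ) × V → ℝ := fun q =>
    q.1.1 * (f (triangleMap G (q.1.2, q.2)) - triangleOp G lam f q.1.2)
  have hH : Measurable H := by
    have h1 := hf.comp hG.measurable_triangleMap
    have h2 := hG.measurable_triangleOp hf
    exact measurable_fst.fst.mul
      ((h1.comp (measurable_fst.snd.prodMk measurable_snd)).sub (h2.comp measurable_fst.snd))
  have hpe : Measurable fun ω => ((φ ω, Y n ω), e n ω) := hp'.prodMk he
  have heq : ∀ ω, φ ω * fluctuation G lam f Y n ω = H ((φ ω, Y n ω), e n ω) := by
    intro ω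
    simp only [H, fluctuation, hY.triangle_eq hn]
  have hint : Integrable (fun ω => H ((φ ω, Y n ω), e n ω)) Pr := by
    refine Integrable.of_bound (C := K * (2 * B)) (hH.comp hpe).aestronglyMeasurable
      (ae_of_all _ fun ω => ?_)
    rw [← heq, Real.norm_eq_abs, abs_mul]
    exact mul_le_mul (hK ω) (abs_fluctuation_le hB n ω) (abs_nonneg _)
      ((abs_nonneg _).trans (hK ω))
  have hint' : Integrable H ((Pr.map fun ω => (φ ω, Y n ω)).prod lam) := by
    rw [← hmap, integrable_map_measure hH.aestronglyMeasurable hpe.aemeasurable]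
    exact hint
  have : IsProbabilityMeasure (Pr.map fun ω => (φ ω, Y n ω)) :=
    Measure.isProbabilityMeasure_map hp'.aemeasurable
  simp only [heq]
  rw [← integral_map hpe.aemeasurable hH.aestronglyMeasurable, hmap, integral_prod _ hint']
  refine integral_eq_zero_of_ae (ae_of_all _ fun q => ?_)
  have hi : Integrable (fun v => f (triangleMap G (q.2, v))) lam :=
    Integrable.of_bound (C := B) ((hf.comp hG.measurable_triangleMap).comp
      measurable_prodMk_left).aestronglyMeasurable (ae_of_all _ fun v => hB _)
  simp only [H, Pi.zero_apply]
  rw [integral_const_mul, integral_sub hi (integrable_const _), integral_const]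
  simp [triangleOp, triangleMap]

/-- Off the diagonal, the fluctuation of smaller index belongs to the past of the other, so the
cross terms vanish and only the diagonal remains. -/
theorem IsTreeProcess.integral_sq_sum_fluctuation_le (hG : IsContracting G a lam)
    (hY : IsTreeProcess Pr G lam F Y e) {f : ℝ × ℝ × ℝ → ℝ} (hf : Measurable f) {B : ℝ}
    (hB : ∀ d, |f d| ≤ B) (I : Finset ℕ) (hI : ∀ i ∈ I, 1 ≤ i) :
    ∫ ω, (∑ i ∈ I, fluctuation G lam f Y i ω) ^ 2 ∂Pr ≤ I.card * (2 * B) ^ 2 := by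
  have hm : ∀ i ∈ I, Measurable (fluctuation G lam f Y i) := fun i hi =>
    (hY.measurable_fluctuation hG hf (hI i hi)).mono (F.le _) le_rfl
  have hb : ∀ i ω, |fluctuation G lam f Y i ω| ≤ 2 * B := abs_fluctuation_le hB
  have hint : ∀ i ∈ I, ∀ j ∈ I,
      Integrable (fun ω => fluctuation G lam f Y i ω * fluctuation G lam f Y j ω) Pr := by
    intro i hi j hj
    refine Integrable.of_bound (C := 2 * B * (2 * B))
      ((hm i hi).mul (hm j hj)).aestronglyMeasurable (ae_of_all _ fun ω => ?_)
    rw [Real.norm_eq_abs, abs_mul]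
    exact mul_le_mul (hb i ω) (hb j ω) (abs_nonneg _) ((abs_nonneg _).trans (hb i ω))
  have hlt : ∀ i ∈ I, ∀ j ∈ I, i < j →
      ∫ ω, fluctuation G lam f Y i ω * fluctuation G lam f Y j ω ∂Pr = 0 := by
    intro i hi j hj hij
    exact hY.integral_mul_fluctuation hG hf hB (hI j hj)
      ((hY.measurable_fluctuation hG hf (hI i hi)).mono (F.mono hij) le_rfl) (hb i)
  simp only [pow_two, Finset.sum_mul_sum]
  rw [integral_finsetSum _ fun i hi => integrable_finsetSum _ fun j hj => hint i hi j hj,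
    ← nsmul_eq_mul]
  refine Finset.sum_le_card_nsmul _ _ _ fun i hi => ?_
  rw [integral_finsetSum _ fun j hj => hint i hi j hj, Finset.sum_eq_single_of_mem i hi]
  · have h1 : ∫ ω, fluctuation G lam f Y i ω * fluctuation G lam f Y i ω ∂Pr
        ≤ ∫ _, 2 * B * (2 * B) ∂Pr := by
      refine integral_mono (hint i hi i hi) (integrable_const _) fun ω => ?_
      rw [← abs_mul_abs_self]
      exact mul_le_mul (hb i ω) (hb i ω) (abs_nonneg _) ((abs_nonneg _).trans (hb i ω))
    simpa using h1
  · intro j hj hji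
    rcases lt_or_gt_of_ne hji with h | h
    · simpa only [mul_comm] using hlt j hj i hi h
    · exact hlt i hi j hj h

/-- The second moment of the mean fluctuation over 2^q vertices is at most (2B)² 2^{-q}, which is
summable. -/
theorem IsTreeProcess.ae_tendsto_average_sub (hG : IsContracting G a lam)
    (hY : IsTreeProcess Pr G lam F Y e) {f : ℝ × ℝ × ℝ → ℝ} (hf : Measurable f) {B : ℝ}
    (hB : ∀ d, |f d| ≤ B) :
    ∀ᵐ ω ∂Pr, Tendsto (fun q => average (generation q) (triangle fun i => Y i ω) f -
      average (generation q) (fun i => Y i ω) (triangleOp G lam f)) atTop (𝓝 0) := by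
  have heq : ∀ q ω, average (generation q) (triangle fun i => Y i ω) f -
      average (generation q) (fun i => Y i ω) (triangleOp G lam f)
        = (2 ^ q)⁻¹ * ∑ i ∈ generation q, fluctuation G lam f Y i ω := by
    intro q ω
    simp [average, card_generation, fluctuation, Finset.sum_sub_distrib, mul_sub]
  simp only [heq]
  have hm : ∀ q, Measurable fun ω => ∑ i ∈ generation q, fluctuation G lam f Y i ω := fun q =>
    Finset.measurable_fun_sum _ fun i hi =>
      (hY.measurable_fluctuation hG hf (one_le_of_mem_generation hi)).mono (F.le _) le_rfl
  refine ae_tendsto_zero_of_integral_sq_le (c := fun q => (2 * B) ^ 2 * (1 / 2) ^ q)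
    (fun q => ?_) (summable_geometric_two.mul_left _) fun q => ?_
  · refine Integrable.of_bound (C := ((2 ^ q)⁻¹ * ∑ i ∈ generation q, 2 * B) ^ 2)
      (((hm q).const_mul _).pow_const 2).aestronglyMeasurable (ae_of_all _ fun ω => ?_)
    rw [Real.norm_of_nonneg (sq_nonneg _), ← sq_abs, abs_mul, abs_of_nonneg (by positivity)]
    gcongr
    exact (Finset.abs_sum_le_sum_abs _ _).trans
      (Finset.sum_le_sum fun i _ => abs_fluctuation_le hB i ω)
  · have h := hY.integral_sq_sum_fluctuation_le hG hf hB (generation q)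
      fun i hi => one_le_of_mem_generation hi
    simp only [mul_pow, integral_const_mul, card_generation] at h ⊢
    calc ((2 : ℝ) ^ q)⁻¹ ^ 2 * ∫ ω, (∑ i ∈ generation q, fluctuation G lam f Y i ω) ^ 2 ∂Pr
        ≤ ((2 : ℝ) ^ q)⁻¹ ^ 2 * (((2 ^ q : ℕ) : ℝ) * (2 ^ 2 * B ^ 2)) := by gcongr
      _ = 2 ^ 2 * B ^ 2 * (1 / 2) ^ q := by
        push_cast
        have h2 : (1 / 2 : ℝ) ^ q = (2 ^ q)⁻¹ := by simp
        rw [h2]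
        field_simp

/-! ### Laws of large numbers -/

theorem IsTreeProcess.ae_tendsto_average_add_sub (hG : IsContracting G a lam)
    (hY : IsTreeProcess Pr G lam F Y e) {g : ℝ → ℝ} (hg : IsBoundedLipschitz g) (k : ℕ) :
    ∀ᵐ ω ∂Pr, Tendsto (fun q => average (generation (q + k)) (fun i => Y i ω) g -
      average (generation q) (fun i => Y i ω) ((meanOp G lam)^[k] g)) atTop (𝓝 0) := by
  obtain ⟨B, L, hL, h⟩ := hg.exists_isBLWith
  induction k with
  | zero => simp
  | succ k ih =>
    have hk := h.iterate_meanOp hG hL k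
    have hkm := hk.continuous.measurable
    -- The mean of Q^k g over the two daughters has conditional expectation Q^(k+1) g at the mother,
    -- and its average over generation q is that of Q^k g over generation q + 1.
    have h1 := hY.ae_tendsto_average_sub hG (B := B)
      (f := fun d => ((meanOp G lam)^[k] g d.2.1 + (meanOp G lam)^[k] g d.2.2) / 2)
      (((hkm.comp measurable_snd.fst).add (hkm.comp measurable_snd.snd)).div_const 2) (fun d => by
        have h1 := abs_le.1 (hk.1 d.2.1)
        have h2 := abs_le.1 (hk.1 d.2.2)
        rw [abs_le]
        constructor <;> linarith [h1.1, h1.2, h2.1, h2.2])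
    filter_upwards [ih, h1] with ω hω hω1
    have := (hω.comp (tendsto_add_atTop_nat 1)).add hω1
    rw [add_zero] at this
    refine this.congr fun q => ?_
    simp only [Function.comp_apply, ← average_generation_succ]
    rw [Function.iterate_succ_apply', show q + 1 + k = q + (k + 1) by ring, sub_add_sub_cancel]
    rfl

theorem IsTreeProcess.ae_tendsto_average_of_isBoundedLipschitz (hG : IsContracting G a lam)
    (hY : IsTreeProcess Pr G lam F Y e) {μ : Measure ℝ} [IsProbabilityMeasure μ]
    (hμ : stepLaw G lam μ = μ) {g : ℝ → ℝ} (hg : IsBoundedLipschitz g) :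
    ∀ᵐ ω ∂Pr, Tendsto (fun q => average (generation q) (fun i => Y i ω) g) atTop
      (𝓝 (∫ x, g x ∂μ)) := by
  obtain ⟨B, L, hL, h⟩ := hg.exists_isBLWith
  filter_upwards [hY.ae_bddAbove_average_norm_pow hG,
    ae_all_iff.2 fun k => hY.ae_tendsto_average_add_sub hG hg k] with ω hM hω
  obtain ⟨M, hM⟩ := hM 1
  -- Q^k g is (L a^k)-Lipschitz, so it is compared with its value at 0 at the cost of an empirical
  -- first moment. The bound is uniform in q, so k can be fixed before q tends to infinity.
  have hbound : ∀ k q, |average (generation q) (fun i => Y i ω) ((meanOp G lam)^[k] g) -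
      ∫ x, g x ∂μ| ≤ L * a ^ k * M + |(meanOp G lam)^[k] g 0 - ∫ x, g x ∂μ| := by
    intro k q
    have hk := (h.iterate_meanOp hG hL k).2
    set m := (meanOp G lam)^[k] g
    set l := ∫ x, g x ∂μ
    have hLa : 0 ≤ L * a ^ k := mul_nonneg hL (pow_nonneg hG.nonneg k)
    have hc : ∀ c : ℝ, average (generation q) (fun i => Y i ω) (fun x => L * a ^ k * ‖x‖ ^ 1 + c)
        ≤ L * a ^ k * M + c := by
      intro c
      rw [average_add, average_const_mul, average_const (generation_nonempty q)]
      gcongr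
      exact hM q
    have hpt : ∀ x, |m x - l| ≤ L * a ^ k * ‖x‖ ^ 1 + |m 0 - l| := by
      intro x
      have := hk x 0
      rw [sub_zero] at this
      calc |m x - l| = |(m x - m 0) + (m 0 - l)| := by ring_nf
        _ ≤ |m x - m 0| + |m 0 - l| := abs_add_le _ _
        _ ≤ _ := by rw [pow_one]; gcongr; exact this
    have hsub : average (generation q) (fun i => Y i ω) m - l
        = average (generation q) (fun i => Y i ω) (fun x => m x + -l) := by
      rw [average_add, average_const (generation_nonempty q), sub_eq_add_neg]
    rw [hsub]
    refine le_trans ?_ (hc _)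
    rw [average, abs_mul, abs_of_nonneg (by positivity : (0 : ℝ) ≤ ((generation q).card : ℝ)⁻¹)]
    refine mul_le_mul_of_nonneg_left ?_ (by positivity)
    exact (Finset.abs_sum_le_sum_abs _ _).trans (Finset.sum_le_sum fun i _ => hpt _)
  have hzero : Tendsto (fun k => L * a ^ k * M + |(meanOp G lam)^[k] g 0 - ∫ x, g x ∂μ|) atTop
      (𝓝 0) := by
    have h1 := ((tendsto_pow_atTop_nhds_zero_of_lt_one hG.nonneg hG.lt_one).const_mul L).mul_const M
    have h2 := ((hG.tendsto_iterate_meanOp hμ hg 0).sub_const (∫ x, g x ∂μ)).abs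
    simpa using h1.add h2
  rw [Metric.tendsto_atTop]
  intro η hη
  obtain ⟨k, hk⟩ := (hzero.eventually_lt_const (half_pos hη)).exists
  obtain ⟨q₀, hq₀⟩ := Metric.tendsto_atTop.1 (hω k) (η / 2) (half_pos hη)
  refine ⟨q₀ + k, fun n hn => ?_⟩
  obtain ⟨q, rfl⟩ : ∃ q, n = q + k := ⟨n - k, by omega⟩
  have h1 := hq₀ q (by omega)
  have h2 := hbound k q
  rw [Real.dist_eq, sub_zero] at h1
  rw [Real.dist_eq]
  refine (abs_sub_le _ (average (generation q) (fun i => Y i ω) ((meanOp G lam)^[k] g))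
    _).trans_lt ?_
  linarith

theorem IsTreeProcess.ae_tendsto_average (hG : IsContracting G a lam)
    (hY : IsTreeProcess Pr G lam F Y e) {μ : Measure ℝ} (hmom : HasMoments μ)
    (hμ : stepLaw G lam μ = μ) :
    ∀ᵐ ω ∂Pr, ∀ f : ℝ → ℝ, IsCPol f →
      Tendsto (fun q => average (generation q) (fun i => Y i ω) f) atTop (𝓝 (∫ x, f x ∂μ)) ∧
      Tendsto (fun r => average (subtree r) (fun i => Y i ω) f) atTop (𝓝 (∫ x, f x ∂μ)) := by
  have := hmom.isProbabilityMeasure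
  exact ae_forall_isCPol_tendsto (Z := fun ω i => Y i ω) hmom (hY.ae_bddAbove_average_norm_pow hG)
    fun g hg => hY.ae_tendsto_average_of_isBoundedLipschitz hG hμ hg

theorem IsTreeProcess.ae_tendsto_average_triangle (hG : IsContracting G a lam)
    (hY : IsTreeProcess Pr G lam F Y e) {μ : Measure ℝ} (hmom : HasMoments μ)
    (hμ : stepLaw G lam μ = μ) :
    ∀ᵐ ω ∂Pr, ∀ f : ℝ × ℝ × ℝ → ℝ, IsCPol f →
      Tendsto (fun q => average (generation q) (triangle fun i => Y i ω) f) atTop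
        (𝓝 (∫ x, triangleOp G lam f x ∂μ)) ∧
      Tendsto (fun r => average (subtree r) (triangle fun i => Y i ω) f) atTop
        (𝓝 (∫ x, triangleOp G lam f x ∂μ)) := by
  have := hmom.isProbabilityMeasure
  have hmt := hG.hasMoments_triangle hmom
  have hpt := hmt.isProbabilityMeasure
  -- For a bounded Lipschitz function of the triangle, add the vanishing mean fluctuation to the law
  -- of large numbers for its conditional expectation.
  have key := ae_forall_isCPol_tendsto (Pr := Pr) (Z := fun ω => triangle fun i => Y i ω) hmt
    (by
      filter_upwards [hY.ae_bddAbove_average_norm_pow hG] with ω hω k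
      obtain ⟨M, hM⟩ := hω k
      exact ⟨M + 2 * M, bddAbove_average_triangle_norm_pow hM⟩)
    (fun g hg => by
      rw [hG.integral_triangle (hg.integrable _)]
      obtain ⟨B, hB⟩ := hg.1
      filter_upwards [hY.ae_tendsto_average_of_isBoundedLipschitz hG hμ (hg.triangleOp hG),
        hY.ae_tendsto_average_sub hG hg.continuous.measurable hB] with ω h1 h2
      simpa using h2.add h1)
  filter_upwards [key] with ω hω f hf
  rw [← hG.integral_triangle (hmt.integrable hf)]
  exact hω f hf

end TreeProcess

/-! ### Construction of the process from its ancestor and its noise -/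

/-- The process on the binary tree with ancestor `x`, dynamics `G` and noise `e`. -/
noncomputable def treeProcess {V : Type*} (G : ℝ → V → ℝ × ℝ) (x : ℝ) (e : ℕ → V) : ℕ → ℝ
  | 0 => x
  | 1 => x
  -- Vertex n + 2 has mother n / 2 + 1, and is an even daughter exactly when n is even.
  | n + 2 =>
    if n % 2 = 0 then (G (treeProcess G x e (n / 2 + 1)) (e (n / 2 + 1))).1
    else (G (treeProcess G x e (n / 2 + 1)) (e (n / 2 + 1))).2

section TreeProcess

variable {V : Type*} (G : ℝ → V → ℝ × ℝ) (x : ℝ) (e : ℕ → V)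

theorem treeProcess_one : treeProcess G x e 1 = x := by rw [treeProcess]

theorem treeProcess_two_mul {n : ℕ} (hn : 1 ≤ n) :
    treeProcess G x e (2 * n) = (G (treeProcess G x e n) (e n)).1 := by
  obtain ⟨n, rfl⟩ := Nat.exists_eq_add_of_le' hn
  rw [show 2 * (n + 1) = 2 * n + 2 by ring, treeProcess, if_pos (by omega),
    show 2 * n / 2 = n by omega]

theorem treeProcess_two_mul_add_one {n : ℕ} (hn : 1 ≤ n) :
    treeProcess G x e (2 * n + 1) = (G (treeProcess G x e n) (e n)).2 := by
  obtain ⟨n, rfl⟩ := Nat.exists_eq_add_of_le' hn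
  rw [show 2 * (n + 1) + 1 = 2 * n + 1 + 2 by ring, treeProcess, if_neg (by omega),
    show (2 * n + 1) / 2 = n by omega]

end TreeProcess

/-- Induction along the binary tree. -/
theorem tree_induction {p : ℕ → Prop} (h1 : p 1) (h2 : ∀ n, 1 ≤ n → p n → p (2 * n))
    (h3 : ∀ n, 1 ≤ n → p n → p (2 * n + 1)) (n : ℕ) (hn : 1 ≤ n) : p n := by
  induction n using Nat.strong_induction_on with
  | _ n ih =>
    rcases eq_or_lt_of_le hn with rfl | hn'
    · exact h1
    rcases Nat.even_or_odd' n with ⟨m, rfl | rfl⟩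
    · exact h2 m (by omega) (ih m (by omega) (by omega))
    · exact h3 m (by omega) (ih m (by omega) (by omega))

/-! ### From an independent sequence to a process on the tree -/

section Independent

variable {Ω V : Type*} {mΩ : MeasurableSpace Ω} [mV : MeasurableSpace V] {u : ℕ → Ω → V}

/-- The filtration whose `n`-th term is generated by the variables of index less than `n`. -/
def pastFiltration (hu : ∀ n, Measurable (u n)) : Filtration ℕ mΩ where
  seq n := ⨆ i ∈ Set.Iio n, mV.comap (u i)
  mono' _ _ hij := biSup_mono fun _ hk => lt_of_lt_of_le hk hij
  le' _ := iSup₂_le fun i _ => (hu i).comap_le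

theorem measurable_pastFiltration (hu : ∀ n, Measurable (u n)) {i n : ℕ} (h : i < n) :
    Measurable[pastFiltration hu n] (u i) :=
  Measurable.mono (comap_measurable (u i))
    (le_iSup₂ (f := fun i (_ : i ∈ Set.Iio n) => mV.comap (u i)) i h) le_rfl

theorem indep_pastFiltration {Pr : Measure Ω} (hu : ∀ n, Measurable (u n)) (h : iIndepFun u Pr)
    (n : ℕ) : Indep (mV.comap (u n)) (pastFiltration hu n) Pr := by
  have := indep_iSup_of_disjoint (fun i => (hu i).comap_le) h.iIndep
    (S := {n}) (T := Set.Iio n) (by simp)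
  rwa [iSup_singleton] at this

/-- The unused index 0 of the noise carries the ancestor. The type at vertex n depends only on `u 0`
and on the noise at strict ancestors of n, all of index less than n. -/
theorem isTreeProcess_treeProcess {Pr : Measure Ω} (hu : ∀ n, Measurable (u n))
    (h : iIndepFun u Pr) {G : ℝ → V → ℝ × ℝ} (hG : Measurable fun p : ℝ × V => G p.1 p.2)
    {lam : Measure V} (hlam : ∀ n, 1 ≤ n → Pr.map (u n) = lam) {root : V → ℝ}
    (hroot : Measurable root) :
    IsTreeProcess Pr G lam (pastFiltration hu)
      (fun n ω => treeProcess G (root (u 0 ω)) (fun i => u i ω) n) u where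
  daughters n hn ω := by
    rw [treeProcess_two_mul G _ _ hn, treeProcess_two_mul_add_one G _ _ hn]
  measurable_type := by
    have step : ∀ n m, 1 ≤ n → n < m →
        Measurable[pastFiltration hu n]
          (fun ω => treeProcess G (root (u 0 ω)) (fun i => u i ω) n) →
        Measurable[pastFiltration hu m]
          fun ω => G (treeProcess G (root (u 0 ω)) (fun i => u i ω) n) (u n ω) := by
      intro n m hn hnm ih
      exact hG.comp ((ih.mono ((pastFiltration hu).mono hnm.le) le_rfl).prodMk
        (measurable_pastFiltration hu hnm))
    refine tree_induction ?_ (fun n hn ih => ?_) fun n hn ih => ?_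
    · simp only [treeProcess_one]
      exact hroot.comp (measurable_pastFiltration hu one_pos)
    · simp only [treeProcess_two_mul G _ _ hn]
      exact measurable_fst.comp (step n (2 * n) hn (by omega) ih)
    · simp only [treeProcess_two_mul_add_one G _ _ hn]
      exact measurable_snd.comp (step n (2 * n + 1) hn (by omega) ih)
  measurable_noise n _ := measurable_pastFiltration hu n.lt_succ_self
  map_noise := hlam
  indep n _ := indep_pastFiltration hu h n

/-- A variable which is independent of an independent sequence extends it to an independent
sequence. -/
theorem iIndepFun_nat_of_indepFun {Pr : Measure Ω} [IsProbabilityMeasure Pr]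
    (hs : iIndepFun (fun n : ℕ+ => u n) Pr)
    (h0 : IndepFun (u 0) (fun ω (n : ℕ+) => u n ω) Pr) : iIndepFun u Pr := by
  rw [iIndepFun_iff_measure_inter_preimage_eq_mul]
  intro S s hms
  -- The product formula over positive indices comes from the independent sequence; index 0, if
  -- present, is split off using its independence from the whole sequence.
  have hpos : ∀ (S' : Finset ℕ), (∀ i ∈ S', i ∈ S) →
      Pr (⋂ i ∈ S'.filter (0 < ·), u i ⁻¹' s i) = ∏ i ∈ S'.filter (0 < ·), Pr (u i ⁻¹' s i) := by
    intro S' hS'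
    let T : Finset ℕ+ := S'.subtype fun i => 0 < i
    have hT : ∀ n : ℕ+, n ∈ T ↔ (n : ℕ) ∈ S' := fun n => Finset.mem_subtype
    have h := hs.measure_inter_preimage_eq_mul T (sets := fun n : ℕ+ => s n)
      fun n hn => hms n (hS' _ ((hT n).1 hn))
    have hprod : ∏ i ∈ S'.filter (0 < ·), Pr (u i ⁻¹' s i) = ∏ n ∈ T, Pr (u n ⁻¹' s n) :=
      (Finset.prod_subtype_eq_prod_filter fun i => Pr (u i ⁻¹' s i)).symm
    rw [hprod, ← h]
    congr 1
    ext ω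
    simp only [Set.mem_iInter, Finset.mem_filter, Set.mem_preimage]
    exact ⟨fun h n hn => h n ⟨(hT n).1 hn, n.2⟩, fun h i hi => h ⟨i, hi.2⟩ ((hT _).2 hi.1)⟩
  by_cases hS0 : 0 ∈ S
  · have hS : S = insert 0 (S.filter (0 < ·)) := by
      ext i
      rcases Nat.eq_zero_or_pos i with rfl | hi
      · simp [hS0]
      · simp [hi, hi.ne']
    have hmeas : MeasurableSet {w : ℕ+ → V | ∀ n : ℕ+, (n : ℕ) ∈ S → w n ∈ s n} := by
      have : {w : ℕ+ → V | ∀ n : ℕ+, (n : ℕ) ∈ S → w n ∈ s n}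
          = ⋂ n : ℕ+, ⋂ _ : (n : ℕ) ∈ S, (fun w : ℕ+ → V => w n) ⁻¹' s n := by
        ext w; simp
      rw [this]
      exact MeasurableSet.iInter fun n => MeasurableSet.iInter fun hn =>
        (measurable_pi_apply n) (hms n hn)
    have h := h0.measure_inter_preimage_eq_mul _ _ (hms 0 hS0) hmeas
    have hpre : (fun ω (n : ℕ+) => u n ω) ⁻¹' {w : ℕ+ → V | ∀ n : ℕ+, (n : ℕ) ∈ S → w n ∈ s n}
        = ⋂ i ∈ S.filter (0 < ·), u i ⁻¹' s i := by
      ext ω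
      simp only [Set.mem_preimage, Set.mem_ofPred_eq, Set.mem_iInter, Finset.mem_filter]
      exact ⟨fun h i hi => h ⟨i, hi.2⟩ hi.1, fun h n hn => h n ⟨hn, n.2⟩⟩
    rw [hpre, hpos S fun _ hi => hi] at h
    rw [hS, Finset.set_biInter_insert, Finset.prod_insert (by simp), ← h]
  · have hS : S = S.filter (0 < ·) := by
      ext i
      rcases Nat.eq_zero_or_pos i with rfl | hi
      · simp [hS0]
      · simp [hi]
    rw [hS]
    exact hpos S fun _ hi => hi

end Independent

/-! ### The bifurcating autoregressive model -/

/-- A continuous linear image of a Gaussian law is Gaussian; this gives the noise all its moments.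
-/
instance isGaussian_noiseLaw (σ ρ : ℝ) : IsGaussian (noiseLaw σ ρ) := by
  have h : (fun v : EuclideanSpace ℝ (Fin 2) => (v 0, v 1))
      = (EuclideanSpace.proj (𝕜 := ℝ) (0 : Fin 2)).prod
        (EuclideanSpace.proj (𝕜 := ℝ) (1 : Fin 2)) := by
    ext v <;> simp
  rw [noiseLaw, h]
  infer_instance

/-- The daughters of a mother of type `x` in the bifurcating autoregressive model. -/
def barMap (α₀ β₀ α₁ β₁ x : ℝ) (e : ℝ × ℝ) : ℝ × ℝ :=
  (α₀ * x + β₀ + e.1, α₁ * x + β₁ + e.2)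

theorem measurable_barMap (α₀ β₀ α₁ β₁ : ℝ) :
    Measurable fun p : ℝ × ℝ × ℝ => barMap α₀ β₀ α₁ β₁ p.1 p.2 := by
  unfold barMap
  fun_prop

theorem isContracting_barMap {α₀ α₁ : ℝ} (hα₀ : α₀ ∈ Set.Ioo (-1 : ℝ) 1)
    (hα₁ : α₁ ∈ Set.Ioo (-1 : ℝ) 1) (β₀ β₁ σ ρ : ℝ) :
    IsContracting (barMap α₀ β₀ α₁ β₁) (max |α₀| |α₁|) (noiseLaw σ ρ) where
  nonneg := le_max_of_le_left (abs_nonneg _)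
  lt_one := max_lt (abs_lt.2 hα₀) (abs_lt.2 hα₁)
  measurable := measurable_barMap _ _ _ _
  norm_sub_le x y e := by
    have h : barMap α₀ β₀ α₁ β₁ x e - barMap α₀ β₀ α₁ β₁ y e = (α₀ * (x - y), α₁ * (x - y)) := by
      ext <;> simp [barMap] <;> ring
    rw [h, Prod.norm_mk, Real.norm_eq_abs, Real.norm_eq_abs, abs_mul, abs_mul,
      max_mul_of_nonneg _ _ (abs_nonneg _)]
  integrable_norm_pow k := by
    have h : barMap α₀ β₀ α₁ β₁ 0 = fun e => (β₀, β₁) + id e := by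
      ext e <;> simp [barMap]
    have hm : MemLp (barMap α₀ β₀ α₁ β₁ 0) k (noiseLaw σ ρ) := by
      rw [h]
      exact (memLp_const (β₀, β₁)).add (IsGaussian.memLp_id (noiseLaw σ ρ) k (by simp))
    exact hm.integrable_norm_pow'

theorem applyTriangle_transition (α₀ β₀ α₁ β₁ σ ρ : ℝ) {f : ℝ × ℝ × ℝ → ℝ} (hf : Measurable f) :
    applyTriangle (transition α₀ β₀ α₁ β₁ σ ρ) f
      = triangleOp (barMap α₀ β₀ α₁ β₁) (noiseLaw σ ρ) f := by
  ext x
  change ∫ yz, f (x, yz.1, yz.2) ∂(noiseLaw σ ρ).map (barMap α₀ β₀ α₁ β₁ x) = _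
  have hx : Measurable (barMap α₀ β₀ α₁ β₁ x) :=
    (measurable_barMap α₀ β₀ α₁ β₁).comp measurable_prodMk_left
  have hfx : Measurable fun yz : ℝ × ℝ => f (x, yz.1, yz.2) := hf.comp measurable_prodMk_left
  rw [integral_map hx.aemeasurable hfx.aestronglyMeasurable]
  rfl

theorem integrable_transition {α₀ β₀ α₁ β₁ σ ρ x : ℝ} {f : ℝ × ℝ × ℝ → ℝ} (hf : Measurable f)
    (h : Integrable (fun e => f (x, barMap α₀ β₀ α₁ β₁ x e)) (noiseLaw σ ρ)) :
    Integrable (fun yz : ℝ × ℝ => f (x, yz.1, yz.2)) (transition α₀ β₀ α₁ β₁ σ ρ x) := by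
  change Integrable _ ((noiseLaw σ ρ).map (barMap α₀ β₀ α₁ β₁ x))
  have hx : Measurable (barMap α₀ β₀ α₁ β₁ x) :=
    (measurable_barMap α₀ β₀ α₁ β₁).comp measurable_prodMk_left
  have hfx : Measurable fun yz : ℝ × ℝ => f (x, yz.1, yz.2) := hf.comp measurable_prodMk_left
  rw [integrable_map_measure hfx.aestronglyMeasurable hx.aemeasurable]
  exact h

theorem bind_inducedKernel_transition (α₀ β₀ α₁ β₁ σ ρ : ℝ) (μ : Measure ℝ)
    [IsProbabilityMeasure μ] : μ.bind (inducedKernel (transition α₀ β₀ α₁ β₁ σ ρ))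
      = stepLaw (barMap α₀ β₀ α₁ β₁) (noiseLaw σ ρ) μ := by
  have hm := measurable_barMap α₀ β₀ α₁ β₁
  have hmx : ∀ x, Measurable (barMap α₀ β₀ α₁ β₁ x) := fun x => hm.comp measurable_prodMk_left
  ext s hs
  have h1 : MeasurableSet ((fun p : ℝ × ℝ × ℝ => (barMap α₀ β₀ α₁ β₁ p.1 p.2).1) ⁻¹' s) :=
    hm.fst hs
  have h2 : MeasurableSet ((fun p : ℝ × ℝ × ℝ => (barMap α₀ β₀ α₁ β₁ p.1 p.2).2) ⁻¹' s) :=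
    hm.snd hs
  rw [Measure.bind_apply hs (Kernel.aemeasurable _), stepLaw, Measure.smul_apply,
    Measure.add_apply, Measure.map_apply hm.fst hs, Measure.map_apply hm.snd hs,
    Measure.prod_apply h1, Measure.prod_apply h2, smul_eq_mul,
    ← lintegral_add_left (measurable_measure_prodMk_left h1),
    ← lintegral_const_mul' _ _ (by simp)]
  refine lintegral_congr fun x => ?_
  have e1 : (transition α₀ β₀ α₁ β₁ σ ρ).fst x s
      = noiseLaw σ ρ ((fun e => (barMap α₀ β₀ α₁ β₁ x e).1) ⁻¹' s) := by
    rw [Kernel.fst_apply' _ _ hs]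
    exact Measure.map_apply (hmx x) (measurable_fst hs)
  have e2 : (transition α₀ β₀ α₁ β₁ σ ρ).snd x s
      = noiseLaw σ ρ ((fun e => (barMap α₀ β₀ α₁ β₁ x e).2) ⁻¹' s) := by
    rw [Kernel.snd_apply' _ _ hs]
    exact Measure.map_apply (hmx x) (measurable_snd hs)
  change (2⁻¹ : ℝ≥0∞) * ((transition α₀ β₀ α₁ β₁ σ ρ).fst x s +
    (transition α₀ β₀ α₁ β₁ σ ρ).snd x s) = _
  rw [e1, e2]
  rfl

/-- The variables of a bifurcating autoregressive model agree almost surely with those of a process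
with measurable noise. -/
theorem IsModel.exists_isTreeProcess {Ω : Type*} [MeasurableSpace Ω] {Pr : Measure Ω}
    [IsProbabilityMeasure Pr] {α₀ β₀ α₁ β₁ σ ρ : ℝ} {ν : Measure ℝ} {X ε : ℕ → Ω → ℝ}
    (hX : IsModel Pr α₀ β₀ α₁ β₁ σ ρ ν X ε) :
    ∃ (F : Filtration ℕ (inferInstance : MeasurableSpace Ω)) (Y : ℕ → Ω → ℝ) (e : ℕ → Ω → ℝ × ℝ),
      IsTreeProcess Pr (barMap α₀ β₀ α₁ β₁) (noiseLaw σ ρ) F Y e ∧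
      ∀ᵐ ω ∂Pr, ∀ n, 1 ≤ n → X n ω = Y n ω := by
  -- The ancestor is stored at index 0, padded by 0 to take values in the noise space.
  let u : ℕ → Ω → ℝ × ℝ := fun n ω => if n = 0 then (X 1 ω, 0) else (ε (2 * n) ω, ε (2 * n + 1) ω)
  have hu0 : u 0 = fun ω => (X 1 ω, 0) := by simp [u]
  have hupos : ∀ n, 1 ≤ n → u n = fun ω => (ε (2 * n) ω, ε (2 * n + 1) ω) := fun n hn => by
    ext1 ω
    simp only [u, if_neg (by omega : n ≠ 0)]
  have hupnat : (fun n : ℕ+ => u n) = fun n : ℕ+ => fun ω => (ε (2 * n) ω, ε (2 * n + 1) ω) :=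
    funext fun n => hupos n n.2
  have hind : iIndepFun u Pr := by
    refine iIndepFun_nat_of_indepFun ?_ ?_
    · rw [hupnat]; exact hX.noise_indep
    · have h := hX.ancestor_indep.comp (φ := fun x : ℝ => (x, (0 : ℝ))) (by fun_prop) measurable_id
      have h' : (fun ω (n : ℕ+) => u n ω)
          = fun ω (n : ℕ+) => (ε (2 * n) ω, ε (2 * n + 1) ω) := by
        ext1 ω; ext1 n; exact congrFun (hupos n n.2) ω
      rw [h', hu0]
      exact h
  have hae : ∀ n, AEMeasurable (u n) Pr := by
    intro n
    rcases Nat.eq_zero_or_pos n with rfl | hn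
    · rw [hu0]; exact hX.ancestor.aemeasurable.prodMk aemeasurable_const
    · rw [hupos n hn]; exact (hX.noise_law n hn).aemeasurable
  -- The model variables are only almost everywhere measurable, while the filtration needs genuinely
  -- measurable ones. Measurable versions keep the laws and the independence.
  let u' : ℕ → Ω → ℝ × ℝ := fun n => (hae n).mk (u n)
  have hu' : ∀ n, Measurable (u' n) := fun n => (hae n).measurable_mk
  have hlaw : ∀ n, 1 ≤ n → Pr.map (u' n) = noiseLaw σ ρ := fun n hn => by
    rw [← Measure.map_congr (hae n).ae_eq_mk, hupos n hn]
    exact (hX.noise_law n hn).map_eq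
  refine ⟨_, _, u', isTreeProcess_treeProcess hu' (hind.congr fun n => (hae n).ae_eq_mk)
    (measurable_barMap α₀ β₀ α₁ β₁) hlaw measurable_fst, ?_⟩
  have heven : ∀ᵐ ω ∂Pr, ∀ n, 1 ≤ n → X (2 * n) ω = α₀ * X n ω + β₀ + ε (2 * n) ω :=
    ae_all_iff.2 fun n => by
      by_cases hn : 1 ≤ n
      · filter_upwards [hX.even n hn] with ω h _ using h
      · exact ae_of_all _ fun ω h => absurd h hn
  have hodd : ∀ᵐ ω ∂Pr, ∀ n, 1 ≤ n → X (2 * n + 1) ω = α₁ * X n ω + β₁ + ε (2 * n + 1) ω :=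
    ae_all_iff.2 fun n => by
      by_cases hn : 1 ≤ n
      · filter_upwards [hX.odd n hn] with ω h _ using h
      · exact ae_of_all _ fun ω h => absurd h hn
  filter_upwards [ae_all_iff.2 fun n => (hae n).ae_eq_mk, heven, hodd] with ω hω h2 h3
  have hnoise : ∀ n, 1 ≤ n → u' n ω = (ε (2 * n) ω, ε (2 * n + 1) ω) := fun n hn => by
    rw [← congrFun (hupos n hn) ω]
    exact (hω n).symm
  refine tree_induction ?_ (fun n hn ih => ?_) fun n hn ih => ?_
  · rw [treeProcess_one]
    change X 1 ω = ((hae 0).mk (u 0) ω).1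
    rw [← hω 0, hu0]
  · rw [treeProcess_two_mul _ _ _ hn, ← ih, hnoise n hn, h2 n hn]
    rfl
  · rw [treeProcess_two_mul_add_one _ _ _ hn, ← ih, hnoise n hn, h3 n hn]
    rfl

theorem one_le_of_mem_subtree {r i : ℕ} (h : i ∈ subtree r) : 1 ≤ i := by
  obtain ⟨q, -, hq⟩ := Finset.mem_biUnion.1 h
  exact one_le_of_mem_generation hq

theorem average_congr {E : Type*} {I : Finset ℕ} {Z Z' : ℕ → E} (h : ∀ i ∈ I, Z i = Z' i)
    (f : E → ℝ) : average I Z f = average I Z' f := by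
  rw [average, average, Finset.sum_congr rfl fun i hi => by rw [h i hi]]

theorem triangle_congr {S : Type*} {x y : ℕ → S} (h : ∀ n, 1 ≤ n → x n = y n) {n : ℕ}
    (hn : 1 ≤ n) : triangle x n = triangle y n := by
  rw [triangle, triangle, h n hn, h (2 * n) (by omega), h (2 * n + 1) (by omega)]

end BAR

/-! ### The theorem for the bifurcating autoregressive model -/

theorem proposition28 {Ω : Type*} [MeasurableSpace Ω] (Pr : Measure Ω) [IsProbabilityMeasure Pr]
    (α₀ β₀ α₁ β₁ σ ρ : ℝ)
    (hα₀ : α₀ ∈ Set.Ioo (-1 : ℝ) 1) (hα₁ : α₁ ∈ Set.Ioo (-1 : ℝ) 1)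
    (hσ : 0 < σ ^ 2) (hρ : ρ ∈ Set.Ioo (-1 : ℝ) 1)
    (ν : Measure ℝ) [IsProbabilityMeasure ν] (X ε : ℕ → Ω → ℝ)
    (hX : BAR.IsModel Pr α₀ β₀ α₁ β₁ σ ρ ν X ε)
    (hν : ∀ m : ℕ, Integrable (fun x : ℝ => |x| ^ m) ν) :
    ∃ μ : Measure ℝ,
      BAR.IsUniqueStationary (BAR.inducedKernel (BAR.transition α₀ β₀ α₁ β₁ σ ρ)) μ ∧
      -- the integrals `(μ, f)`, `P f` and `(μ, P f)` are well defined
      (∀ f : ℝ → ℝ, BAR.IsCPol f → Integrable f μ) ∧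
      (∀ f : ℝ × ℝ × ℝ → ℝ, BAR.IsCPol f →
        (∀ x, Integrable (fun yz : ℝ × ℝ => f (x, yz.1, yz.2))
          (BAR.transition α₀ β₀ α₁ β₁ σ ρ x)) ∧
        Integrable (BAR.applyTriangle (BAR.transition α₀ β₀ α₁ β₁ σ ρ) f) μ) ∧
      -- (i)
      (∀ᵐ ω ∂Pr, ∀ f : ℝ → ℝ, BAR.IsCPol f →
        Tendsto (fun q => BAR.average (BAR.generation q) (fun i => X i ω) f) atTop
          (𝓝 (∫ x, f x ∂μ)) ∧
        Tendsto (fun r => BAR.average (BAR.subtree r) (fun i => X i ω) f) atTop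
          (𝓝 (∫ x, f x ∂μ))) ∧
      -- (ii)
      (∀ᵐ ω ∂Pr, ∀ f : ℝ × ℝ × ℝ → ℝ, BAR.IsCPol f →
        Tendsto (fun q => BAR.average (BAR.generation q)
            (BAR.triangle fun i => X i ω) f) atTop
          (𝓝 (∫ x, BAR.applyTriangle (BAR.transition α₀ β₀ α₁ β₁ σ ρ) f x ∂μ)) ∧
        Tendsto (fun r => BAR.average (BAR.subtree r)
            (BAR.triangle fun i => X i ω) f) atTop
          (𝓝 (∫ x, BAR.applyTriangle (BAR.transition α₀ β₀ α₁ β₁ σ ρ) f x ∂μ))) := by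
  have hG := BAR.isContracting_barMap hα₀ hα₁ β₀ β₁ σ ρ
  obtain ⟨μ, hmom, hμ⟩ := hG.exists_stepLaw_eq
  have hp := hmom.isProbabilityMeasure
  obtain ⟨F, Y, e, hY, hXY⟩ := hX.exists_isTreeProcess
  refine ⟨μ, ⟨hp, ?_, fun μ' hp' hμ' => ?_⟩, fun f hf => hmom.integrable hf,
    fun f hf => ⟨fun x => ?_, ?_⟩, ?_, ?_⟩
  · rw [Kernel.Invariant, BAR.bind_inducedKernel_transition, hμ]
  · rw [Kernel.Invariant, BAR.bind_inducedKernel_transition] at hμ'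
    exact hG.eq_of_stepLaw_eq hμ hμ'
  · exact BAR.integrable_transition hf.1.measurable (hG.integrable_apply_of_isCPol hf x)
  · rw [BAR.applyTriangle_transition _ _ _ _ _ _ hf.1.measurable]
    exact hG.integrable_triangleOp ((hG.hasMoments_triangle hmom).integrable hf)
  · filter_upwards [hY.ae_tendsto_average hG hmom hμ, hXY] with ω h hω f hf
    have hg : ∀ q, ∀ i ∈ BAR.generation q, X i ω = Y i ω := fun q i hi =>
      hω i (BAR.one_le_of_mem_generation hi)
    have hs : ∀ r, ∀ i ∈ BAR.subtree r, X i ω = Y i ω := fun r i hi =>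
      hω i (BAR.one_le_of_mem_subtree hi)
    simpa only [BAR.average_congr (hg _), BAR.average_congr (hs _)] using h f hf
  · filter_upwards [hY.ae_tendsto_average_triangle hG hmom hμ, hXY] with ω h hω f hf
    have hg : ∀ q, ∀ i ∈ BAR.generation q,
        BAR.triangle (fun i => X i ω) i = BAR.triangle (fun i => Y i ω) i := fun q i hi =>
      BAR.triangle_congr hω (BAR.one_le_of_mem_generation hi)
    have hs : ∀ r, ∀ i ∈ BAR.subtree r,
        BAR.triangle (fun i => X i ω) i = BAR.triangle (fun i => Y i ω) i := fun r i hi =>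
      BAR.triangle_congr hω (BAR.one_le_of_mem_subtree hi)
    rw [BAR.applyTriangle_transition _ _ _ _ _ _ hf.1.measurable]
    simpa only [BAR.average_congr (hg _), BAR.average_congr (hs _)] using h f hf
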